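/- Digraphs are finite and simple (no loops and no multiple arcs; two opposite arcs between a pair of vertices are allowed). A complementarity eigenvalue of a digraph $D$ with adjacency matrix $A$ is a real number $\lambda$ for which there is a vector $x\neq 0$ with $x\ge 0$ and $Ax\ge\lambda x$ (entrywise) and $\langle x, Ax-\lambda x\rangle=0$. Write $\vec C_n$ for the directed cycle $1\to 2\to\cdots\to n\to 1$ ($n\ge 2$). **Theorem.** Let $D$ be a strongly connected digraph with exactly three complementarity eigenvalues. Then $D$ belongs to the $\infty$-family (items 1–3) or to the $\theta$-family (items 4–7); that is, $D$ is isomorphic to one of the following digraphs. 1. An $\infty$-digraph $\infty(r,s)$, $r,s\ge 2$: the union of two cycles $\vec C_r$ with vertices $1,2,\dots,r$ and $\vec C_s$ with vertices $1',2',\dots,s'$, which have exactly the vertex $1=1'$ in common. 2. A Type 1 digraph: $\infty(r,s)$ together with the arc $(r,2')$, where $r,s\ge2$. 3. A Type 2 digraph: $\infty(r,s)$ together with the arcs $(r,2')$ and $(s',2)$, where $r,s\ge2$. 4. A $\theta$-digraph $\theta(a,b,c)$ with integers $0\le a\le b$, $b>0$, $c\ge 0$: the union of three directed paths with $a+2$,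 $b+2$, $c+2$ vertices, the first two leading from a vertex $w$ to a vertex $v\ne w$ and the third from $v$ to $w$, no two of which share a vertex other than $v$ and $w$. 5. A Type 3 digraph: $\vec C_n$ together with the arcs $(1,i)$ and $(i-1,j)$, where $2<i<j\le n$. 6. A Type 4 digraph: $\vec C_n$ together with $k\ge 2$ arcs $(x_1,y_1),\dots,(x_k,y_k)$, where $1\le y_1<x_1<y_2<x_2<\cdots<y_k<x_k\le n$. 7. A Type 5 digraph: $\vec C_n$ together with the arcs $(1,i)$, $(i-1,j)$ and $(j-1,2)$, where $3<i<i+1<j\le n$. -/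

import Mathlib

namespace CompSpec

/-- `lam` is a complementarity eigenvalue of the real square matrix `A`: there is a nonzero
entrywise nonnegative vector `x` with `A x ≥ lam x` entrywise and `⟨x, A x - lam x⟩ = 0`. -/
def IsComplementarityEigenvalue {V : Type*} [Fintype V] (A : Matrix V V ℝ) (lam : ℝ) : Prop :=
  ∃ x : V → ℝ, x ≠ 0 ∧ (∀ i, 0 ≤ x i) ∧ (∀ i, lam * x i ≤ (A.mulVec x) i) ∧
    x ⬝ᵥ (A.mulVec x - lam • x) = 0

/-- The complementarity spectrum of a real square matrix. -/
def matrixComplementaritySpectrum {V : Type*} [Fintype V] (A : Matrix V V ℝ) : Set ℝ :=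
  {lam | IsComplementarityEigenvalue A lam}

open Classical in
/-- The adjacency matrix of a digraph. -/
noncomputable def adjMatrix {V : Type*} (D : Digraph V) : Matrix V V ℝ :=
  Matrix.of fun i j => if D.Adj i j then 1 else 0

/-- The complementarity spectrum of a finite digraph. -/
noncomputable def complementaritySpectrum {V : Type*} [Fintype V] (D : Digraph V) : Set ℝ :=
  matrixComplementaritySpectrum (adjMatrix D)

/-- A digraph is simple if it has no loops (parallel arcs do not exist for `Digraph`; a pair of
opposite arcs is allowed). -/
def IsSimple {V : Type*} (D : Digraph V) : Prop := ∀ v, ¬ D.Adj v v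

/-- Every vertex can be reached from every vertex along a directed path. -/
def IsStronglyConnected {V : Type*} (D : Digraph V) : Prop :=
  Nonempty V ∧ ∀ u v, Relation.ReflTransGen D.Adj u v

/-- `(u, v)` is an arc of the directed cycle whose vertices are, in order,
`p 1, p 2, …, p r` (labels are read modulo `r`, so `p r` is followed by `p 1`). -/
def CycleArc {V : Type*} {r : ℕ} (p : ZMod r → V) (u v : V) : Prop :=
  ∃ k : ZMod r, u = p k ∧ v = p (k + 1)

/-- `(u, v)` is an arc of the directed path `P 0, P 1, …, P (m + 1)`. -/
def PathArc {V : Type*} {m : ℕ} (P : Fin (m + 2) → V) (u v : V) : Prop :=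
  ∃ k : Fin (m + 1), u = P k.castSucc ∧ v = P k.succ

/-- `p` labels the vertices of a cycle of length `r ≥ 2` by `1, 2, …, r`, and `q` those of a cycle
of length `s ≥ 2` by `1', 2', …, s'`; the two cycles share exactly the vertex `1 = 1'`, and
together they cover `V`. -/
structure IsCoalescence {V : Type*} (r s : ℕ) (p : ZMod r → V) (q : ZMod s → V) : Prop where
  two_le_left : 2 ≤ r
  two_le_right : 2 ≤ s
  left_injective : Function.Injective p
  right_injective : Function.Injective q
  base : p 1 = q 1
  meet : ∀ i j, p i = q j → i = 1 ∧ j = 1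
  cover : ∀ v, (∃ i, p i = v) ∨ (∃ j, q j = v)

/-- `D` is an `∞`-digraph: the coalescence of two cycles at one vertex. -/
def IsInftyDigraph {V : Type*} (D : Digraph V) : Prop :=
  ∃ (r s : ℕ) (p : ZMod r → V) (q : ZMod s → V), IsCoalescence r s p q ∧
    ∀ u v, D.Adj u v ↔ CycleArc p u v ∨ CycleArc q u v

/-- Type 1: `∞(r, s)` together with the arc `(r, 2')`. -/
def IsType1 {V : Type*} (D : Digraph V) : Prop :=
  ∃ (r s : ℕ) (p : ZMod r → V) (q : ZMod s → V), IsCoalescence r s p q ∧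
    ∀ u v, D.Adj u v ↔ CycleArc p u v ∨ CycleArc q u v ∨ (u = p (r : ZMod r) ∧ v = q 2)

/-- Type 2: `∞(r, s)` together with the arcs `(r, 2')` and `(s', 2)`. -/
def IsType2 {V : Type*} (D : Digraph V) : Prop :=
  ∃ (r s : ℕ) (p : ZMod r → V) (q : ZMod s → V), IsCoalescence r s p q ∧
    ∀ u v, D.Adj u v ↔ CycleArc p u v ∨ CycleArc q u v ∨
      (u = p (r : ZMod r) ∧ v = q 2) ∨ (u = q (s : ZMod s) ∧ v = p 2)

/-- `P`, `Q`, `R` are directed paths with `a + 2`, `b + 2`, `c + 2` vertices that together cover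
`V`; `P` and `Q` lead from `w` to `v`, `R` leads from `v` to `w`, and apart from `v` and `w`
no two of them have a vertex in common. Since multiple arcs are not allowed, `a` and `b` are
not both zero, and one takes `a ≤ b`. -/
structure IsThetaPaths {V : Type*} (a b c : ℕ) (w v : V)
    (P : Fin (a + 2) → V) (Q : Fin (b + 2) → V) (R : Fin (c + 2) → V) : Prop where
  le : a ≤ b
  pos : 0 < b
  injective_P : Function.Injective P
  injective_Q : Function.Injective Q
  injective_R : Function.Injective R
  start_P : P 0 = w
  start_Q : Q 0 = w
  start_R : R 0 = v
  end_P : P (Fin.last _) = v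
  end_Q : Q (Fin.last _) = v
  end_R : R (Fin.last _) = w
  meet_PQ : ∀ i j, P i = Q j → P i = w ∨ P i = v
  meet_PR : ∀ i j, P i = R j → P i = w ∨ P i = v
  meet_QR : ∀ i j, Q i = R j → Q i = w ∨ Q i = v
  cover : ∀ x, (∃ i, P i = x) ∨ (∃ i, Q i = x) ∨ (∃ i, R i = x)

/-- `D` is a `θ`-digraph `θ(a, b, c)`. -/
def IsThetaDigraph {V : Type*} (D : Digraph V) : Prop :=
  ∃ (a b c : ℕ) (w v : V) (P : Fin (a + 2) → V) (Q : Fin (b + 2) → V) (R : Fin (c + 2) → V),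
    IsThetaPaths a b c w v P Q R ∧
    ∀ x y, D.Adj x y ↔ PathArc P x y ∨ PathArc Q x y ∨ PathArc R x y

/-- Type 3: a spanning cycle `1, 2, …, n` together with the arcs `(1, i)` and `(i - 1, j)`,
where `2 < i < j ≤ n`. -/
def IsType3 {V : Type*} (D : Digraph V) : Prop :=
  ∃ (n : ℕ) (p : ZMod n → V) (i j : ℕ), Function.Bijective p ∧ 2 < i ∧ i < j ∧ j ≤ n ∧
    ∀ u v, D.Adj u v ↔ CycleArc p u v ∨
      (u = p 1 ∧ v = p (i : ZMod n)) ∨ (u = p ((i - 1 : ℕ) : ZMod n) ∧ v = p (j : ZMod n))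

/-- Type 4: a spanning cycle `1, 2, …, n` together with `k ≥ 2` arcs `(x_i, y_i)`, where
`1 ≤ y_1 < x_1 < y_2 < x_2 < ⋯ < y_k < x_k ≤ n`. -/
def IsType4 {V : Type*} (D : Digraph V) : Prop :=
  ∃ (n : ℕ) (p : ZMod n → V) (k : ℕ) (x y : Fin k → ℕ), Function.Bijective p ∧ 2 ≤ k ∧
    (∀ i, 1 ≤ y i ∧ y i < x i ∧ x i ≤ n) ∧ (∀ i j, i < j → x i < y j) ∧
    ∀ u v, D.Adj u v ↔ CycleArc p u v ∨
      ∃ i, u = p (x i : ZMod n) ∧ v = p (y i : ZMod n)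

/-- Type 5: a spanning cycle `1, 2, …, n` together with the arcs `(1, i)`, `(i - 1, j)` and
`(j - 1, 2)`, where `3 < i < i + 1 < j ≤ n`. -/
def IsType5 {V : Type*} (D : Digraph V) : Prop :=
  ∃ (n : ℕ) (p : ZMod n → V) (i j : ℕ), Function.Bijective p ∧ 3 < i ∧ i + 1 < j ∧ j ≤ n ∧
    ∀ u v, D.Adj u v ↔ CycleArc p u v ∨
      (u = p 1 ∧ v = p (i : ZMod n)) ∨ (u = p ((i - 1 : ℕ) : ZMod n) ∧ v = p (j : ZMod n)) ∨
      (u = p ((j - 1 : ℕ) : ZMod n) ∧ v = p 2)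

/-- The `∞`-family. -/
def InftyFamily {V : Type*} (D : Digraph V) : Prop :=
  IsInftyDigraph D ∨ IsType1 D ∨ IsType2 D

/-- The `θ`-family. -/
def ThetaFamily {V : Type*} (D : Digraph V) : Prop :=
  IsThetaDigraph D ∨ IsType3 D ∨ IsType4 D ∨ IsType5 D

end CompSpec

/-! The spectrum enters only through one combinatorial consequence. The Perron value of a strongly
connected induced subdigraph is a complementarity eigenvalue: extend the Perron vector by zero. A
single vertex gives 0 and an induced cycle gives 1. If a proper strong induced subdigraph had a
vertex with two out-neighbours in it, its Perron value would exceed 1 and lie strictly below that of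
`D`, giving four eigenvalues. So three eigenvalues make `D` thin (`isThin_of_ncard_eq_three`). They
also force a vertex of out-degree at least two, since otherwise only 0 and 1 can occur.

The rest is an ear argument. A shortest closed walk is an induced cycle; a shortest ear on it,
together with the cycle, is strong and branching, so by thinness it covers all vertices
(`IsInducedCycle.exists_isEarForm`). Minimality leaves three freedoms: several cycle vertices may
enter the ear, its end may return to several cycle vertices, and the ear may carry backward arcs.
Thinness, applied to a cycle segment closed up by the ear (`IsEarForm.thin_segment`), restricts all
three. Backward arcs lead to Type 4. Without them, if no exit directly follows an entry on the
cycle, entry and exit are unique and the digraph is an ∞- or θ-digraph. If some exit does follow an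
entry, at most one more of each exists, which leaves θ and Types 1, 2, 3 and 5. -/

namespace CompSpec

open Matrix Relation

/-! ### Perron theory for nonnegative matrices, by maximising the value of a sub-eigenvector -/

section Perron

variable {W : Type*} [Fintype W]

/-- `y` is a nonzero nonnegative vector with `A y ≥ μ y`. -/
structure IsSubEigenvector (A : Matrix W W ℝ) (μ : ℝ) (y : W → ℝ) : Prop where
  nonneg : ∀ i, 0 ≤ y i
  ne_zero : ∃ i, 0 < y i
  le : ∀ i, μ * y i ≤ (A *ᵥ y) i

theorem mulVec_nonneg_of_nonneg {A : Matrix W W ℝ} (hA : ∀ i j, 0 ≤ A i j) {y : W → ℝ}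
    (hy : ∀ i, 0 ≤ y i) (i : W) : 0 ≤ (A *ᵥ y) i :=
  Finset.sum_nonneg fun j _ => mul_nonneg (hA i j) (hy j)

theorem mulVec_pos_of_pos {A : Matrix W W ℝ} (hA : ∀ i j, 0 ≤ A i j) {y : W → ℝ}
    (hy : ∀ i, 0 ≤ y i) {i j : W} (hij : 0 < A i j) (hj : 0 < y j) : 0 < (A *ᵥ y) i :=
  Finset.sum_pos' (fun k _ => mul_nonneg (hA i k) (hy k)) ⟨j, Finset.mem_univ _, mul_pos hij hj⟩

/-- Sum the inequalities over all coordinates and bound each `y j` by the total. This confines the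
maximisation to a compact interval of values. -/
theorem IsSubEigenvector.le_sum {A : Matrix W W ℝ} (hA : ∀ i j, 0 ≤ A i j) {μ : ℝ} {y : W → ℝ}
    (h : IsSubEigenvector A μ y) : μ ≤ ∑ i, ∑ j, A i j := by
  have hs : 0 < ∑ i, y i := by
    obtain ⟨i, hi⟩ := h.ne_zero
    exact Finset.sum_pos' (fun k _ => h.nonneg k) ⟨i, Finset.mem_univ _, hi⟩
  refine le_of_mul_le_mul_right ?_ hs
  calc μ * ∑ i, y i = ∑ i, μ * y i := Finset.mul_sum _ _ _
    _ ≤ ∑ i, ∑ j, A i j * y j := Finset.sum_le_sum fun i _ => h.le i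
    _ ≤ ∑ i, ∑ j, A i j * ∑ k, y k := by
        refine Finset.sum_le_sum fun i _ => Finset.sum_le_sum fun j _ => ?_
        exact mul_le_mul_of_nonneg_left
          (Finset.single_le_sum (fun k _ => h.nonneg k) (Finset.mem_univ j)) (hA i j)
    _ = (∑ i, ∑ j, A i j) * ∑ k, y k := by simp only [Finset.sum_mul]

/-- The largest `μ` admitting a sub-eigenvector is attained. -/
theorem exists_maximal_subEigenvector [Nonempty W] {A : Matrix W W ℝ} (hA : ∀ i j, 0 ≤ A i j) :
    ∃ (lam : ℝ) (y : W → ℝ), IsSubEigenvector A lam y ∧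
      ∀ μ z, IsSubEigenvector A μ z → μ ≤ lam := by
  classical
  -- Normalising to the simplex and keeping only values at least 0 makes the problem compact; the
  -- constant vector, admissible for 0, shows that nothing is lost.
  let K : Set (ℝ × (W → ℝ)) :=
    (Set.Icc 0 (∑ i, ∑ j, A i j) ×ˢ stdSimplex ℝ W) ∩ {q | ∀ i, q.1 * q.2 i ≤ (A *ᵥ q.2) i}
  have hsub : ∀ q ∈ K, IsSubEigenvector A q.1 q.2 := by
    rintro ⟨l, y⟩ ⟨⟨-, hy⟩, hle⟩
    refine ⟨hy.1, ?_, hle⟩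
    by_contra! hc
    have : ∑ i, y i ≤ 0 := Finset.sum_nonpos fun i _ => hc i
    have h1 : ∑ i, y i = 1 := hy.2
    linarith
  have hmem : ∀ μ z, 0 ≤ μ → IsSubEigenvector A μ z → ∃ y, (μ, y) ∈ K := by
    intro μ z hμ hz
    have hs : 0 < ∑ i, z i := by
      obtain ⟨i, hi⟩ := hz.ne_zero
      exact Finset.sum_pos' (fun k _ => hz.nonneg k) ⟨i, Finset.mem_univ _, hi⟩
    refine ⟨(∑ i, z i)⁻¹ • z, ⟨⟨⟨hμ, hz.le_sum hA⟩, ?_, ?_⟩, ?_⟩⟩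
    · intro i
      exact mul_nonneg (inv_nonneg.2 hs.le) (hz.nonneg i)
    · simp only [Pi.smul_apply, smul_eq_mul, ← Finset.mul_sum]
      exact inv_mul_cancel₀ hs.ne'
    · intro i
      simp only [mulVec_smul, Pi.smul_apply, smul_eq_mul]
      have := mul_le_mul_of_nonneg_left (hz.le i) (inv_nonneg.2 hs.le)
      linarith
  have hKc : IsCompact K := by
    refine (isCompact_Icc.prod (isCompact_stdSimplex ℝ W)).inter_right ?_
    simp only [Set.ofPred_forall]
    refine isClosed_iInter fun i => isClosed_le (by fun_prop) ?_
    simp only [mulVec, dotProduct]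
    fun_prop
  have hKn : K.Nonempty := by
    obtain ⟨y, hy⟩ := hmem 0 (fun _ => 1) le_rfl
      ⟨fun _ => zero_le_one, ⟨Classical.arbitrary W, zero_lt_one⟩, fun i => by
        rw [zero_mul]; exact mulVec_nonneg_of_nonneg hA (fun _ => zero_le_one) i⟩
    exact ⟨_, hy⟩
  obtain ⟨q, hq, hmax⟩ := hKc.exists_isMaxOn hKn continuous_fst.continuousOn
  refine ⟨q.1, q.2, hsub q hq, fun μ z hz => ?_⟩
  rcases lt_or_ge μ 0 with h | h
  · exact h.le.trans hq.1.1.1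
  · obtain ⟨y, hy⟩ := hmem μ z h hz
    exact hmax hy

/-- For an irreducible matrix a sub-eigenvector at the maximal value is an eigenvector. -/
theorem IsSubEigenvector.mulVec_eq {A : Matrix W W ℝ} (hA : ∀ i j, 0 ≤ A i j)
    (hirr : ∀ i j, ReflTransGen (fun i j => 0 < A i j) i j) {lam : ℝ} {y : W → ℝ}
    (hy : IsSubEigenvector A lam y) (hmax : ∀ μ z, IsSubEigenvector A μ z → μ ≤ lam) (i : W) :
    (A *ᵥ y) i = lam * y i := by
  by_contra hne
  have hi : lam * y i < (A *ᵥ y) i := lt_of_le_of_ne (hy.le i) (Ne.symm hne)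
  -- Strictness travels backwards along arcs: if `z` is strict at `b` and `A a b > 0`, applying `A`
  -- to the nonnegative defect `A z - lam z` gives a positive entry at `a`, so `z + A z` is strict
  -- at `a`.
  have hstep : ∀ k, ∃ z, IsSubEigenvector A lam z ∧ lam * z k < (A *ᵥ z) k := by
    intro k
    refine ReflTransGen.head_induction_on (hirr k i) ⟨y, hy, hi⟩ ?_
    rintro a b hab - ⟨z, hz, hlt⟩
    have hd : ∀ j, 0 ≤ (A *ᵥ z - lam • z) j := fun j => by
      have := hz.le j
      simp only [Pi.sub_apply, Pi.smul_apply, smul_eq_mul]; linarith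
    have hAd : ∀ j, (A *ᵥ (A *ᵥ z - lam • z)) j = (A *ᵥ (A *ᵥ z)) j - lam * (A *ᵥ z) j := by
      intro j
      rw [mulVec_sub, mulVec_smul]; rfl
    refine ⟨z + A *ᵥ z, ⟨fun j => add_nonneg (hz.nonneg j)
      (mulVec_nonneg_of_nonneg hA hz.nonneg j), ?_, fun j => ?_⟩, ?_⟩
    · obtain ⟨j, hj⟩ := hz.ne_zero
      exact ⟨j, add_pos_of_pos_of_nonneg hj (mulVec_nonneg_of_nonneg hA hz.nonneg j)⟩
    · have h1 := mulVec_nonneg_of_nonneg hA hd j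
      rw [hAd] at h1
      have h2 := hz.le j
      rw [mulVec_add]
      simp only [Pi.add_apply]
      linarith
    · have h1 := mulVec_pos_of_pos hA hd hab (j := b) (by
        simp only [Pi.sub_apply, Pi.smul_apply, smul_eq_mul]; linarith)
      rw [hAd] at h1
      have h2 := hz.le a
      rw [mulVec_add]
      simp only [Pi.add_apply]
      linarith
  choose z hz hlt using hstep
  have hS : ∀ k, (A *ᵥ (∑ l, z l)) k = ∑ l, (A *ᵥ z l) k := by
    intro k
    rw [mulVec_sum, Finset.sum_apply]
  -- The sum of the witnesses is strict everywhere, so `lam` could be raised, against maximality.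
  -- Below, the `+ 1` in the denominator avoids division by a vanishing coordinate.
  have hstrict : ∀ k, lam * (∑ l, z l) k < (A *ᵥ (∑ l, z l)) k := by
    intro k
    rw [hS, Finset.sum_apply, Finset.mul_sum]
    exact Finset.sum_lt_sum (fun l _ => (hz l).le k) ⟨k, Finset.mem_univ _, hlt k⟩
  have hnn : ∀ k, 0 ≤ (∑ l, z l) k := by
    intro k
    rw [Finset.sum_apply]
    exact Finset.sum_nonneg fun l _ => (hz l).nonneg k
  have : Nonempty W := ⟨i⟩
  obtain ⟨k, hk⟩ := Finite.exists_min fun k : W =>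
    ((A *ᵥ (∑ l, z l)) k - lam * (∑ l, z l) k) / ((∑ l, z l) k + 1)
  set δ := ((A *ᵥ (∑ l, z l)) k - lam * (∑ l, z l) k) / ((∑ l, z l) k + 1) with hδ
  have hδpos : 0 < δ := div_pos (sub_pos.2 (hstrict k)) (by linarith [hnn k])
  have := hmax (lam + δ) (∑ l, z l) ⟨hnn, ?_, fun j => ?_⟩
  · linarith
  · obtain ⟨j, hj⟩ := (hz i).ne_zero
    refine ⟨j, ?_⟩
    rw [Finset.sum_apply]
    exact Finset.sum_pos' (fun l _ => (hz l).nonneg j) ⟨i, Finset.mem_univ _, hj⟩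
  · have h1 := hk j
    have h2 := hnn j
    rw [le_div_iff₀ (by linarith)] at h1
    nlinarith

/-- At a zero coordinate of a nonnegative eigenvector all out-neighbours vanish as well, so by
irreducibility one zero would spread to every coordinate. -/
theorem pos_of_mulVec_eq {A : Matrix W W ℝ} (hA : ∀ i j, 0 ≤ A i j)
    (hirr : ∀ i j, ReflTransGen (fun i j => 0 < A i j) i j) {lam : ℝ} {y : W → ℝ}
    (hy : ∀ i, 0 ≤ y i) (hne : ∃ i, 0 < y i) (heq : ∀ i, (A *ᵥ y) i = lam * y i) (i : W) :
    0 < y i := by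
  by_contra hi
  have hi : y i = 0 := le_antisymm (not_lt.1 hi) (hy i)
  have key : ∀ j, ReflTransGen (fun i j => 0 < A i j) i j → y j = 0 := by
    intro j hj
    induction hj with
    | refl => exact hi
    | tail _ hab ih =>
      by_contra hb
      have h1 := mulVec_pos_of_pos hA hy hab (lt_of_le_of_ne (hy _) (Ne.symm hb))
      rw [heq, ih, mul_zero] at h1
      exact lt_irrefl _ h1
  obtain ⟨j, hj⟩ := hne
  exact hj.ne' (key j (hirr i j))

end Perron

/-! ### From three complementarity eigenvalues to thinness -/

section Spectrum

variable {V : Type*}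

theorem adjMatrix_apply_of_adj {D : Digraph V} {u v : V} (h : D.Adj u v) :
    adjMatrix D u v = 1 := by simp [adjMatrix, h]

theorem adjMatrix_nonneg (D : Digraph V) (u v : V) : 0 ≤ adjMatrix D u v := by
  simp only [adjMatrix, of_apply]; split_ifs <;> norm_num

theorem adjMatrix_pos_iff {D : Digraph V} {u v : V} : 0 < adjMatrix D u v ↔ D.Adj u v := by
  by_cases h : D.Adj u v <;> simp [adjMatrix, h]

/-- The subdigraph induced on `S` is strongly connected. -/
def StrongOn (D : Digraph V) (S : Set V) : Prop :=
  ∀ u ∈ S, ∀ v ∈ S, ReflTransGen (fun a b => D.Adj a b ∧ a ∈ S ∧ b ∈ S) u v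

/-- Proper strongly connected induced subdigraphs are vertices or cycles: no vertex of such a
subdigraph has two out-neighbours in it. -/
def IsThin (D : Digraph V) : Prop :=
  ∀ S : Set V, S ≠ Set.univ → StrongOn D S →
    ∀ u ∈ S, ∀ v ∈ S, ∀ w ∈ S, D.Adj u v → D.Adj u w → v = w

theorem StrongOn.exists_adj {D : Digraph V} {S : Set V} (h : StrongOn D S) {u v : V}
    (hu : u ∈ S) (hv : v ∈ S) (huv : u ≠ v) : ∃ w ∈ S, D.Adj u w := by
  rcases (h u hu v hv).cases_head with h | ⟨w, hw, -⟩
  · exact absurd h huv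
  · exact ⟨w, hw.2.2, hw.1⟩

theorem StrongOn.subtype {D : Digraph V} {S : Set V} (h : StrongOn D S) (u v : S) :
    ReflTransGen (fun i j : S => 0 < (adjMatrix D).submatrix Subtype.val Subtype.val i j) u v := by
  have key : ∀ v' : V, ReflTransGen (fun a b => D.Adj a b ∧ a ∈ S ∧ b ∈ S) u.1 v' →
      ∀ hv' : v' ∈ S, ReflTransGen (fun i j : S =>
        0 < (adjMatrix D).submatrix Subtype.val Subtype.val i j) u ⟨v', hv'⟩ := by
    intro v' hv'
    induction hv' with
    | refl => intro _; exact ReflTransGen.refl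
    | tail _ hab ih =>
      intro hb
      exact (ih hab.2.1).tail (adjMatrix_pos_iff.2 hab.1)
  exact key v.1 (h u.1 u.2 v.1 v.2) v.2

variable [Fintype V]

theorem adjMatrix_mulVec_eq_sum_subtype (D : Digraph V) (S : Set V) [Fintype S] {x : V → ℝ}
    (hx : ∀ v ∉ S, x v = 0) (i : V) :
    (adjMatrix D *ᵥ x) i = ∑ j : S, adjMatrix D i j * x j := by
  classical
  simp only [mulVec, dotProduct]
  rw [← Finset.sum_subset (Finset.subset_univ S.toFinset)]
  · exact Finset.sum_subtype _ (fun v => by simp) _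
  · intro v _ hv
    rw [hx v (by simpa using hv), mul_zero]

/-- The spectral radius of a nontrivial strongly connected induced subdigraph, with its Perron
vector extended by zero. -/
theorem StrongOn.exists_perron {D : Digraph V} {S : Set V} (h : StrongOn D S)
    (hne : S.Nonempty) :
    ∃ (lam : ℝ) (x : V → ℝ), (∀ v ∈ S, 0 < x v) ∧ (∀ v ∉ S, x v = 0) ∧
      (∀ v ∈ S, (adjMatrix D *ᵥ x) v = lam * x v) ∧
      ∀ (μ : ℝ) (y : V → ℝ), (∀ v, 0 ≤ y v) → (∀ v ∉ S, y v = 0) → (∃ v, 0 < y v) →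
        (∀ v ∈ S, μ * y v ≤ (adjMatrix D *ᵥ y) v) →
        μ ≤ lam ∧ (μ = lam → ∀ v ∈ S, 0 < y v ∧ (adjMatrix D *ᵥ y) v = lam * y v) := by
  classical
  have : Nonempty S := hne.to_subtype
  set A : Matrix S S ℝ := (adjMatrix D).submatrix Subtype.val Subtype.val with hAdef
  have hA : ∀ i j, 0 ≤ A i j := fun i j => adjMatrix_nonneg D _ _
  have hirr : ∀ i j, ReflTransGen (fun i j => 0 < A i j) i j := h.subtype
  obtain ⟨lam, y, hy, hmax⟩ := exists_maximal_subEigenvector hA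
  have heq := hy.mulVec_eq hA hirr hmax
  have hpos := pos_of_mulVec_eq hA hirr hy.nonneg hy.ne_zero heq
  have hext : ∀ (z : V → ℝ), (∀ v ∉ S, z v = 0) → ∀ i : S,
      (adjMatrix D *ᵥ z) i = (A *ᵥ fun j => z j) i := by
    intro z hz i
    rw [adjMatrix_mulVec_eq_sum_subtype D S hz]
    rfl
  refine ⟨lam, fun v => if hv : v ∈ S then y ⟨v, hv⟩ else 0, ?_, ?_, ?_, ?_⟩
  · intro v hv
    simpa [hv] using hpos ⟨v, hv⟩
  · intro v hv
    simp [hv]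
  · intro v hv
    have := hext (fun v => if hv : v ∈ S then y ⟨v, hv⟩ else 0)
      (fun v hv => by simp [hv]) ⟨v, hv⟩
    simp only [Subtype.coe_prop, dite_true, Subtype.coe_eta] at this
    simp only [hv, dite_true]
    rw [this]
    exact heq ⟨v, hv⟩
  -- Vectors supported in `S` restrict to sub-eigenvectors of the principal submatrix, so maximality
  -- and its equality case transfer to them.
  · intro μ z hz0 hzS ⟨w, hw⟩ hle
    have hwS : w ∈ S := by
      by_contra hc
      exact hw.ne' (hzS w hc)
    have hsub : IsSubEigenvector A μ fun j : S => z j :=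
      ⟨fun i => hz0 i, ⟨⟨w, hwS⟩, hw⟩, fun i => by
        rw [← hext z hzS]; exact hle i i.2⟩
    refine ⟨hmax μ _ hsub, ?_⟩
    rintro rfl v hv
    have e := hsub.mulVec_eq hA hirr hmax
    refine ⟨pos_of_mulVec_eq hA hirr hsub.nonneg hsub.ne_zero e ⟨v, hv⟩, ?_⟩
    exact (hext z hzS ⟨v, hv⟩).trans (e ⟨v, hv⟩)

/-- Off `S` the vector is zero while `A x` is nonnegative, so the inequality holds there and
contributes nothing to the inner product. -/
theorem mem_complementaritySpectrum_of_eigenvector {D : Digraph V} {S : Set V} {lam : ℝ}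
    {x : V → ℝ} (hne : S.Nonempty) (hpos : ∀ v ∈ S, 0 < x v) (hzero : ∀ v ∉ S, x v = 0)
    (heq : ∀ v ∈ S, (adjMatrix D *ᵥ x) v = lam * x v) : lam ∈ complementaritySpectrum D := by
  have hnn : ∀ v, 0 ≤ x v := fun v => by
    by_cases hv : v ∈ S
    · exact (hpos v hv).le
    · rw [hzero v hv]
  refine ⟨x, ?_, hnn, fun v => ?_, ?_⟩
  · rintro rfl
    obtain ⟨v, hv⟩ := hne
    exact lt_irrefl _ (hpos v hv)
  · by_cases hv : v ∈ S
    · exact (heq v hv).ge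
    · rw [hzero v hv, mul_zero]
      exact mulVec_nonneg_of_nonneg (adjMatrix_nonneg D) hnn v
  · refine Finset.sum_eq_zero fun v _ => ?_
    by_cases hv : v ∈ S
    · simp [heq v hv]
    · rw [hzero v hv, zero_mul]

/-- A digraph with all out-degrees at most one has no complementarity eigenvalues besides
`0` and `1`. -/
theorem complementaritySpectrum_subset_of_functional {D : Digraph V}
    (h : ∀ u v w, D.Adj u v → D.Adj u w → v = w) : complementaritySpectrum D ⊆ {0, 1} := by
  classical
  rintro lam ⟨x, hx0, hnn, hle, horth⟩
  -- The orthogonality condition is a vanishing sum of nonnegative terms, so equality holds on the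
  -- support.
  have heq : ∀ v, 0 < x v → (adjMatrix D *ᵥ x) v = lam * x v := by
    intro v hv
    have h1 : ∀ i ∈ Finset.univ, 0 ≤ x i * (adjMatrix D *ᵥ x - lam • x) i := fun i _ =>
      mul_nonneg (hnn i) (by
        have := hle i
        simp only [Pi.sub_apply, Pi.smul_apply, smul_eq_mul]; linarith)
    have h2 := (Finset.sum_eq_zero_iff_of_nonneg h1).1 horth v (Finset.mem_univ v)
    rcases mul_eq_zero.1 h2 with h3 | h3
    · exact absurd h3 hv.ne'
    · simp only [Pi.sub_apply, Pi.smul_apply, smul_eq_mul] at h3; linarith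
  have hmv : ∀ v, (adjMatrix D *ᵥ x) v = 0 ∨ ∃ w, (adjMatrix D *ᵥ x) v = x w := by
    intro v
    by_cases hv : ∃ w, D.Adj v w
    · obtain ⟨w, hw⟩ := hv
      right
      refine ⟨w, ?_⟩
      simp only [mulVec, dotProduct]
      rw [Finset.sum_eq_single w]
      · rw [adjMatrix_apply_of_adj hw, one_mul]
      · intro b _ hb
        have : ¬ D.Adj v b := fun hvb => hb (h v b w hvb hw)
        simp [adjMatrix, this]
      · simp
    · left
      push Not at hv
      exact Finset.sum_eq_zero fun w _ => by simp [adjMatrix, hv w]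
  obtain ⟨v0, hv0⟩ : ∃ v, 0 < x v := by
    by_contra! hc
    exact hx0 (funext fun v => le_antisymm (hc v) (hnn v))
  by_contra hlam
  simp only [Set.mem_insert_iff, Set.mem_singleton_iff, not_or] at hlam
  have hpos : 0 < lam := by
    have h1 := mulVec_nonneg_of_nonneg (adjMatrix_nonneg D) hnn v0
    rw [heq v0 hv0] at h1
    exact lt_of_le_of_ne (nonneg_of_mul_nonneg_left h1 hv0) (Ne.symm hlam.1)
  have hnext : ∀ v, 0 < x v → ∃ w, x w = lam * x v := by
    intro v hv
    rcases hmv v with h1 | ⟨w, h1⟩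
    · rw [heq v hv] at h1
      exact absurd h1 (mul_pos hpos hv).ne'
    · exact ⟨w, by rw [← h1, heq v hv]⟩
  -- Multiplication by `lam` maps positive coordinates to coordinates: the least positive one rules
  -- out `lam < 1`, the largest rules out `lam > 1`.
  rcases lt_or_gt_of_ne hlam.2 with hlt | hgt
  · obtain ⟨v, hv, hmin⟩ := Finset.exists_min_image (Finset.univ.filter fun v => 0 < x v) x
      ⟨v0, by simpa using hv0⟩
    simp only [Finset.mem_filter, Finset.mem_univ, true_and] at hv hmin
    obtain ⟨w, hw⟩ := hnext v hv
    have := hmin w (by rw [hw]; exact mul_pos hpos hv)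
    nlinarith
  · obtain ⟨v, -, hmax⟩ := Finset.exists_max_image Finset.univ x ⟨v0, Finset.mem_univ _⟩
    have hv : 0 < x v := hv0.trans_le (hmax v0 (Finset.mem_univ _))
    obtain ⟨w, hw⟩ := hnext v hv
    have := hmax w (Finset.mem_univ _)
    nlinarith

/-- Test with the indicator of `S`. Every vertex of `S` has an out-neighbour in `S`, so 1 is
admissible; were it extremal, the indicator would be an eigenvector for 1, but its image at `u` is
at least 2. -/
theorem one_lt_of_branching {D : Digraph V} {S : Set V} {u v w : V}
    (hu : u ∈ S) (hv : v ∈ S) (hw : w ∈ S) (huv : D.Adj u v) (huw : D.Adj u w) (hvw : v ≠ w)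
    (hout : ∀ u ∈ S, ∃ v ∈ S, D.Adj u v) {lam : ℝ}
    (hmax : ∀ (μ : ℝ) (y : V → ℝ), (∀ v, 0 ≤ y v) → (∀ v ∉ S, y v = 0) → (∃ v, 0 < y v) →
        (∀ v ∈ S, μ * y v ≤ (adjMatrix D *ᵥ y) v) →
        μ ≤ lam ∧ (μ = lam → ∀ v ∈ S, 0 < y v ∧ (adjMatrix D *ᵥ y) v = lam * y v)) :
    1 < lam := by
  classical
  let y : V → ℝ := fun v => if v ∈ S then 1 else 0
  have hy0 : ∀ v, 0 ≤ y v := fun v => by simp only [y]; split_ifs <;> norm_num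
  have hterm : ∀ a b, 0 ≤ adjMatrix D a b * y b := fun a b =>
    mul_nonneg (adjMatrix_nonneg D a b) (hy0 b)
  obtain ⟨h1, h2⟩ := hmax 1 y hy0 (fun v hv => by simp [y, hv]) ⟨u, by simp [y, hu]⟩ (by
    intro a ha
    obtain ⟨b, hb, hab⟩ := hout a ha
    have : adjMatrix D a b * y b ≤ (adjMatrix D *ᵥ y) a :=
      Finset.single_le_sum (f := fun b => adjMatrix D a b * y b)
        (fun b _ => hterm a b) (Finset.mem_univ b)
    simpa [y, ha, hb, adjMatrix_apply_of_adj hab] using this)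
  refine lt_of_le_of_ne h1 fun he => ?_
  have h3 := (h2 he u hu).2
  have h4 : ∑ b ∈ {v, w}, adjMatrix D u b * y b ≤ (adjMatrix D *ᵥ y) u :=
    Finset.sum_le_sum_of_subset_of_nonneg (Finset.subset_univ _) fun b _ _ => hterm u b
  rw [Finset.sum_pair hvw, h3, ← he] at h4
  simp [y, hu, hv, hw, adjMatrix_apply_of_adj huv, adjMatrix_apply_of_adj huw] at h4
  norm_num at h4

theorem zero_mem_complementaritySpectrum [Nonempty V] {D : Digraph V} (hD : IsSimple D) :
    (0 : ℝ) ∈ complementaritySpectrum D := by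
  classical
  let v : V := Classical.arbitrary V
  refine mem_complementaritySpectrum_of_eigenvector (S := {v}) (x := Pi.single v 1) ⟨v, rfl⟩ ?_ ?_ ?_
  · rintro w rfl; simp
  · intro w hw; exact Pi.single_eq_of_ne hw _
  · rintro w rfl
    simp [adjMatrix, hD _]

theorem one_mem_complementaritySpectrum {D : Digraph V} {C : Set V} (hne : C.Nonempty)
    (h : ∀ u ∈ C, ∃! v, v ∈ C ∧ D.Adj u v) : (1 : ℝ) ∈ complementaritySpectrum D := by
  classical
  refine mem_complementaritySpectrum_of_eigenvector (S := C)
    (x := fun v => if v ∈ C then 1 else 0) hne (fun v hv => by simp [hv])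
    (fun v hv => by simp [hv]) fun u hu => ?_
  obtain ⟨v, ⟨hv, huv⟩, huniq⟩ := h u hu
  simp only [mulVec, dotProduct]
  rw [Finset.sum_eq_single v]
  · simp [hu, hv, adjMatrix_apply_of_adj huv]
  · intro b _ hb
    by_cases hbC : b ∈ C
    · have : ¬ D.Adj u b := fun hub => hb (huniq b ⟨hbC, hub⟩)
      simp [adjMatrix, this]
    · simp [hbC]
  · simp

/-- The combinatorial content of having exactly three complementarity eigenvalues. -/
theorem isThin_of_ncard_eq_three {D : Digraph V} (hsimple : IsSimple D)
    (hstrong : IsStronglyConnected D) (hthree : (complementaritySpectrum D).ncard = 3)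
    {C : Set V} (hne : C.Nonempty) (hC : ∀ u ∈ C, ∃! v, v ∈ C ∧ D.Adj u v) : IsThin D := by
  intro S hS hSs u hu v hv w hw huv huw
  by_contra hvw
  have := hstrong.1
  have hVs : StrongOn D Set.univ := fun a _ b _ =>
    ReflTransGen.mono (fun _ _ h => ⟨h, Set.mem_univ _, Set.mem_univ _⟩) _ _ (hstrong.2 a b)
  have huv' : u ≠ v := fun e => hsimple u (by rw [← e] at huv; exact huv)
  have outS : ∀ a ∈ S, ∃ b ∈ S, D.Adj a b := by
    intro a ha
    by_cases hau : a = u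
    · exact hSs.exists_adj ha hv (by rw [hau]; exact huv')
    · exact hSs.exists_adj ha hu hau
  obtain ⟨l1, x1, hp1, hz1, he1, hm1⟩ := hSs.exists_perron ⟨u, hu⟩
  obtain ⟨l2, x2, hp2, hz2, he2, hm2⟩ := hVs.exists_perron ⟨u, trivial⟩
  have h1 : 1 < l1 := one_lt_of_branching hu hv hw huv huw hvw outS hm1
  have hnn1 : ∀ a, 0 ≤ x1 a := fun a => by
    by_cases ha : a ∈ S
    · exact (hp1 a ha).le
    · rw [hz1 a ha]
  obtain ⟨h2, h3⟩ := hm2 l1 x1 hnn1 (fun a ha => absurd trivial ha) ⟨u, hp1 u hu⟩ (by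
    intro a _
    by_cases ha : a ∈ S
    · exact (he1 a ha).ge
    · rw [hz1 a ha, mul_zero]
      exact mulVec_nonneg_of_nonneg (adjMatrix_nonneg D) hnn1 a)
  have h12 : l1 < l2 := by
    -- Equality would force the extended Perron vector of `S` to be positive everywhere, yet it
    -- vanishes off `S`.
    refine lt_of_le_of_ne h2 fun he => ?_
    obtain ⟨a, ha⟩ := (Set.ne_univ_iff_exists_notMem S).1 hS
    exact (h3 he a trivial).1.ne' (hz1 a ha)
  have hsub : (({0, 1, l1, l2} : Finset ℝ) : Set ℝ) ⊆ complementaritySpectrum D := by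
    intro a ha
    simp only [Finset.coe_insert, Finset.coe_singleton, Set.mem_insert_iff,
      Set.mem_singleton_iff] at ha
    rcases ha with rfl | rfl | rfl | rfl
    · exact zero_mem_complementaritySpectrum hsimple
    · exact one_mem_complementaritySpectrum hne hC
    · exact mem_complementaritySpectrum_of_eigenvector ⟨u, hu⟩ hp1 hz1 he1
    · exact mem_complementaritySpectrum_of_eigenvector (S := Set.univ) ⟨u, trivial⟩ hp2 hz2 he2
  have hfin : (complementaritySpectrum D).Finite :=
    Set.finite_of_ncard_ne_zero (by rw [hthree]; norm_num)
  have hcard := Set.ncard_le_ncard hsub hfin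
  rw [hthree, Set.ncard_coe_finset, Finset.card_insert_of_notMem,
    Finset.card_insert_of_notMem, Finset.card_pair h12.ne] at hcard
  · omega
  · simp only [Finset.mem_insert, Finset.mem_singleton, not_or]
    exact ⟨by linarith, by linarith⟩
  · simp only [Finset.mem_insert, Finset.mem_singleton, not_or]
    exact ⟨by norm_num, by linarith, by linarith⟩

theorem exists_branching_of_ncard_eq_three {D : Digraph V}
    (hthree : (complementaritySpectrum D).ncard = 3) :
    ∃ u v w, D.Adj u v ∧ D.Adj u w ∧ v ≠ w := by
  by_contra! hc
  have h := Set.ncard_le_ncard (complementaritySpectrum_subset_of_functional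
    (D := D) fun u v w huv huw => hc u v w huv huw)
  rw [hthree, Set.ncard_pair zero_ne_one] at h
  omega

end Spectrum

end CompSpec

/-! ### Induced cycles, shortest ears and the restrictions imposed by thinness -/

namespace CompSpec

open Relation

variable {V : Type*}

theorem ReflTransGen.of_chain {R : V → V → Prop} {f : ℕ → V} {a b : ℕ} (hab : a ≤ b)
    (h : ∀ k, a ≤ k → k < b → R (f k) (f (k + 1))) : ReflTransGen R (f a) (f b) := by
  induction b, hab using Nat.le_induction with
  | base => exact ReflTransGen.refl
  | succ n hn ih =>
    exact (ih fun k h1 h2 => h k h1 (by omega)).tail (h n hn (by omega))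

/-- Walks are functions on `ℕ` whose values beyond the length are irrelevant, so splicing two walks
is an `if` on the index. -/
theorem ReflTransGen.exists_walk {R : V → V → Prop} {u v : V} (h : ReflTransGen R u v) :
    ∃ (n : ℕ) (f : ℕ → V), f 0 = u ∧ f n = v ∧ ∀ k < n, R (f k) (f (k + 1)) := by
  induction h with
  | refl => exact ⟨0, fun _ => u, rfl, rfl, fun k hk => by omega⟩
  | @tail b c _ hbc ih =>
    obtain ⟨n, f, h0, hn, hw⟩ := ih
    refine ⟨n + 1, fun k => if k ≤ n then f k else c, by simpa using h0, by simp, ?_⟩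
    intro k hk
    by_cases hkn : k + 1 ≤ n
    · simpa [hkn, show k ≤ n by omega] using hw k (by omega)
    · obtain rfl : k = n := by omega
      simpa [hn] using hbc

theorem StrongOn.of_root {D : Digraph V} {S : Set V} (w : V)
    (hto : ∀ u ∈ S, ReflTransGen (fun a b => D.Adj a b ∧ a ∈ S ∧ b ∈ S) u w)
    (hfrom : ∀ u ∈ S, ReflTransGen (fun a b => D.Adj a b ∧ a ∈ S ∧ b ∈ S) w u) :
    StrongOn D S := fun u hu v hv => (hto u hu).trans (hfrom v hv)

/-- `c 0, …, c (r - 1)` is an induced cycle of `D`. -/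
structure IsInducedCycle (D : Digraph V) (r : ℕ) (c : ℕ → V) : Prop where
  two_le : 2 ≤ r
  inj : ∀ a b, a < r → b < r → c a = c b → a = b
  adj_iff : ∀ a b, a < r → b < r → (D.Adj (c a) (c b) ↔ b = a + 1 ∨ (a + 1 = r ∧ b = 0))

/-- A shortest closed walk is an induced cycle. -/
theorem exists_isInducedCycle {D : Digraph V} (hsimple : IsSimple D)
    (hstrong : IsStronglyConnected D) {u v : V} (huv : D.Adj u v) :
    ∃ r c, IsInducedCycle D r c := by
  classical
  have hex : ∃ n, 1 ≤ n ∧ ∃ f : ℕ → V, f n = f 0 ∧ ∀ k < n, D.Adj (f k) (f (k + 1)) := by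
    obtain ⟨n, f, h0, hn, hw⟩ := ReflTransGen.exists_walk (hstrong.2 v u)
    refine ⟨n + 1, by omega, fun k => if k ≤ n then f k else v, by simp [h0], ?_⟩
    intro k hk
    by_cases hkn : k + 1 ≤ n
    · simpa [hkn, show k ≤ n by omega] using hw k (by omega)
    · obtain rfl : k = n := by omega
      simpa [hn] using huv
  obtain ⟨hpos, f, hf, hw⟩ := Nat.find_spec hex
  have hmin := fun n (h : n < Nat.find hex) => Nat.find_min hex h
  set r := Nat.find hex with hr
  clear_value r
  have two : 2 ≤ r := by
    by_contra hc
    obtain rfl : r = 1 := by omega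
    have := hw 0 (by omega)
    rw [zero_add, hf] at this
    exact hsimple _ this
  refine ⟨r, f, two, ?_, ?_⟩
  · have key : ∀ a b, a < b → b < r → f a ≠ f b := by
      intro a b hab hb he
      refine hmin (b - a) (by omega) ⟨by omega, fun k => f (a + k), ?_, ?_⟩
      · simp only [add_zero]
        rw [show a + (b - a) = b by omega, he]
      · intro k hk
        exact hw (a + k) (by omega)
    intro a b ha hb he
    rcases lt_trichotomy a b with h | h | h
    · exact absurd he (key a b h hb)
    · exact h
    · exact absurd he.symm (key b a h ha)
  · intro a b ha hb
    constructor
    · intro hab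
      rcases le_or_gt b a with h | h
      -- A chord from `a` back to `b ≤ a` closes a walk of length `a - b + 1`, shorter than `r`
      -- except for the closing arc of the cycle.
      · right
        by_contra hc
        refine hmin (a - b + 1) (by omega)
          ⟨by omega, fun k => if k ≤ a - b then f (b + k) else f b, by simp, ?_⟩
        intro k hk
        by_cases hk' : k + 1 ≤ a - b
        · simpa [hk', show k ≤ a - b by omega, add_assoc] using hw (b + k) (by omega)
        · obtain rfl : k = a - b := by omega
          simpa [show b + (a - b) = a by omega] using hab
      · left
        by_contra hc
        -- A forward chord bypasses `b - a - 1` vertices of the closed walk.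
        refine hmin (r - (b - a - 1)) (by omega)
          ⟨by omega, fun k => if k ≤ a then f k else f (k + (b - a - 1)), ?_, ?_⟩
        · simp only [Nat.zero_le, if_true]
          rw [if_neg (by omega), show r - (b - a - 1) + (b - a - 1) = r by omega, hf]
        · intro k hk
          rcases lt_trichotomy k a with h1 | h1 | h1
          · simpa [show k ≤ a by omega, show k + 1 ≤ a by omega] using hw k (by omega)
          · subst h1
            simpa [show k + 1 + (b - k - 1) = b by omega] using hab
          · simpa [show ¬ k ≤ a by omega, show ¬ k + 1 ≤ a by omega,
              show k + 1 + (b - a - 1) = k + (b - a - 1) + 1 by omega] using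
              hw (k + (b - a - 1)) (by omega)
    · rintro (rfl | ⟨h, rfl⟩)
      · exact hw a ha
      · have := hw a ha
        rwa [h, hf] at this

/-- `D` is the union of the induced cycle `c 0, …, c (r - 1)` and a shortest ear with inner
vertices `p 0, …, p (m - 1)`. -/
structure IsEarForm (D : Digraph V) (r m : ℕ) (c p : ℕ → V) : Prop where
  cycle : IsInducedCycle D r c
  one_le : 1 ≤ m
  inj : ∀ a b, a < m → b < m → p a = p b → a = b
  disj : ∀ a b, a < r → b < m → c a ≠ p b
  cover : ∀ v, (∃ a < r, v = c a) ∨ (∃ b < m, v = p b)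
  enter : ∀ a b, a < r → b < m → D.Adj (c a) (p b) → b = 0
  leave : ∀ a b, a < m → b < r → D.Adj (p a) (c b) → a + 1 = m
  step : ∀ a, a + 1 < m → D.Adj (p a) (p (a + 1))
  noskip : ∀ a b, a < m → b < m → D.Adj (p a) (p b) → b ≤ a + 1
  exists_enter : ∃ a < r, D.Adj (c a) (p 0)
  exists_leave : ∃ b < r, D.Adj (p (m - 1)) (c b)

/-- Chordlessness is used three ways: it gives the eigenvalue 1, it shows that a branching digraph
is larger than the cycle, and it names the out-neighbour that competes with an ear's first vertex.
-/
theorem IsInducedCycle.existsUnique {D : Digraph V} {r : ℕ} {c : ℕ → V}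
    (h : IsInducedCycle D r c) {u : V} (hu : ∃ a < r, u = c a) :
    ∃! v, (∃ a < r, v = c a) ∧ D.Adj u v := by
  have h2 := h.two_le
  obtain ⟨a, ha, rfl⟩ := hu
  by_cases hr : a + 1 = r
  · refine ⟨c 0, ⟨⟨0, by omega, rfl⟩, (h.adj_iff a 0 ha (by omega)).2 (Or.inr ⟨hr, rfl⟩)⟩, ?_⟩
    rintro _ ⟨⟨b, hb, rfl⟩, hab⟩
    rcases (h.adj_iff a b ha hb).1 hab with h1 | ⟨-, rfl⟩
    · omega
    · rfl
  · refine ⟨c (a + 1), ⟨⟨a + 1, by omega, rfl⟩,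
      (h.adj_iff a (a + 1) ha (by omega)).2 (Or.inl rfl)⟩, ?_⟩
    rintro _ ⟨⟨b, hb, rfl⟩, hab⟩
    rcases (h.adj_iff a b ha hb).1 hab with rfl | ⟨h1, -⟩
    · rfl
    · omega

/-- Outside the cycle there is a shortest ear; it exhausts a thin digraph. -/
theorem IsInducedCycle.exists_isEarForm {D : Digraph V} (hstrong : IsStronglyConnected D)
    (hthin : IsThin D) (hbr : ∃ u v w, D.Adj u v ∧ D.Adj u w ∧ v ≠ w) {r : ℕ} {c : ℕ → V}
    (hc : IsInducedCycle D r c) : ∃ m p, IsEarForm D r m c p := by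
  classical
  have h2 := hc.two_le
  set C : Set V := {v | ∃ a < r, v = c a} with hC
  have hcC : ∀ a, a < r → c a ∈ C := fun a ha => ⟨a, ha, rfl⟩
  obtain ⟨z, hz⟩ : ∃ z, z ∉ C := by
    by_contra! hall
    obtain ⟨u, v, w, huv, huw, hvw⟩ := hbr
    exact hvw ((hc.existsUnique (hall u)).unique ⟨hall v, huv⟩ ⟨hall w, huw⟩)
  have harc : ∃ u v, u ∈ C ∧ v ∉ C ∧ D.Adj u v := by
    have key : ∀ w, ReflTransGen D.Adj (c 0) w → w ∉ C → ∃ u v, u ∈ C ∧ v ∉ C ∧ D.Adj u v := by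
      intro w hw
      induction hw with
      | refl => exact fun h => absurd (hcC 0 (by omega)) h
      | @tail a b _ hab ih =>
        intro hb
        by_cases ha : a ∈ C
        · exact ⟨a, b, ha, hb, hab⟩
        · exact ih ha
    exact key z (hstrong.2 _ _) hz
  -- Here `m` counts the inner vertices. Requiring `g 1 ∉ C` forces a genuine departure from the
  -- cycle; minimality of `m` then keeps the whole interior off `C`.
  have hex : ∃ m, ∃ g : ℕ → V, g 0 ∈ C ∧ g 1 ∉ C ∧ g (m + 1) ∈ C ∧
      ∀ k < m + 1, D.Adj (g k) (g (k + 1)) := by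
    obtain ⟨u, v, hu, hv, huv⟩ := harc
    obtain ⟨n, f, h0, hn, hw⟩ := ReflTransGen.exists_walk (hstrong.2 v (c 0))
    refine ⟨n, fun k => if k = 0 then u else f (k - 1), by simpa using hu, by simpa [h0] using hv,
      by simpa [hn] using hcC 0 (by omega), ?_⟩
    intro k hk
    rcases k with _ | k
    · simpa [h0] using huv
    · simpa using hw k (by omega)
  obtain ⟨g, hg0, hg1, hgm, hw⟩ := Nat.find_spec hex
  have hmin := fun n (h : n < Nat.find hex) => Nat.find_min hex h
  set m := Nat.find hex with hm
  clear_value m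
  have one : 1 ≤ m := by
    by_contra hlt
    obtain rfl : m = 0 := by omega
    exact hg1 hgm
  have hout : ∀ b, b < m → g (b + 1) ∉ C := by
    intro b hb hbC
    exact hmin b hb ⟨g, hg0, hg1, hbC, fun k hk => hw k (by omega)⟩
  have hstep : ∀ a, a + 1 < m → D.Adj (g (a + 1)) (g (a + 1 + 1)) := fun a ha =>
    hw (a + 1) (by omega)
  obtain ⟨x, hx, hgx⟩ := hg0
  obtain ⟨y, hy, hgy⟩ := hgm
  have hX : D.Adj (c x) (g (0 + 1)) := by rw [← hgx]; exact hw 0 (by omega)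
  have hY : D.Adj (g (m - 1 + 1)) (c y) := by
    rw [← hgy, show m - 1 + 1 = m by omega]; exact hw m (by omega)
  refine ⟨m, fun k => g (k + 1), hc, one, ?_, ?_, ?_, ?_, ?_, hstep, ?_, ⟨x, hx, hX⟩,
    ⟨y, hy, hY⟩⟩
  · have key : ∀ a b, a < b → b < m → g (a + 1) ≠ g (b + 1) := by
      intro a b hab hb he
      refine hmin (m - (b - a)) (by omega)
        ⟨fun k => if k ≤ a + 1 then g k else g (k + (b - a)), ?_, ?_, ?_, ?_⟩
      · simpa [hgx] using hcC x hx
      · simpa using hg1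
      · beta_reduce
        rw [if_neg (by omega), show m - (b - a) + 1 + (b - a) = m + 1 by omega, hgy]
        exact hcC y hy
      · intro k hk
        rcases lt_trichotomy k (a + 1) with h1 | h1 | h1
        · simpa [show k ≤ a + 1 by omega, show k + 1 ≤ a + 1 by omega] using hw k (by omega)
        · subst h1
          have := hw (b + 1) (by omega)
          rw [← he] at this
          simpa [show a + 1 + 1 + (b - a) = b + 1 + 1 by omega] using this
        · simpa [show ¬ k ≤ a + 1 by omega, show ¬ k + 1 ≤ a + 1 by omega,
            show ¬ k ≤ a by omega, show k + 1 + (b - a) = k + (b - a) + 1 by omega] using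
            hw (k + (b - a)) (by omega)
    intro a b ha hb he
    rcases lt_trichotomy a b with h | h | h
    · exact absurd he (key a b h hb)
    · exact h
    · exact absurd he.symm (key b a h ha)
  · intro a b ha hb he
    exact hout b hb (he ▸ hcC a ha)
  -- The cycle with its ear is strong and branches at `c x`, so thinness forces it to be everything.
  · set S : Set V := {v | (∃ a < r, v = c a) ∨ (∃ b < m, v = g (b + 1))} with hS
    have cS : ∀ a, a < r → c a ∈ S := fun a ha => Or.inl ⟨a, ha, rfl⟩
    have pS : ∀ b, b < m → g (b + 1) ∈ S := fun b hb => Or.inr ⟨b, hb, rfl⟩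
    have cstep : ∀ a, a + 1 < r → D.Adj (c a) (c (a + 1)) := fun a ha =>
      (hc.adj_iff a (a + 1) (by omega) ha).2 (Or.inl rfl)
    have cchain : ∀ a b, a ≤ b → b < r →
        ReflTransGen (fun a b => D.Adj a b ∧ a ∈ S ∧ b ∈ S) (c a) (c b) := fun a b hab hb =>
      ReflTransGen.of_chain hab fun k _ h => ⟨cstep k (by omega), cS k (by omega), cS _ (by omega)⟩
    have pchain : ∀ a b, a ≤ b → b < m →
        ReflTransGen (fun a b => D.Adj a b ∧ a ∈ S ∧ b ∈ S) (g (a + 1)) (g (b + 1)) :=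
      fun a b hab hb => ReflTransGen.of_chain (f := fun k => g (k + 1)) hab fun k _ h =>
        ⟨hstep k (by omega), pS k (by omega), pS _ (by omega)⟩
    have c0 : ∀ a, a < r → ReflTransGen (fun a b => D.Adj a b ∧ a ∈ S ∧ b ∈ S) (c a) (c 0) :=
      fun a ha => (cchain a (r - 1) (by omega) (by omega)).tail
        ⟨(hc.adj_iff _ _ (by omega) (by omega)).2 (Or.inr ⟨by omega, rfl⟩), cS _ (by omega),
          cS _ (by omega)⟩
    have hstr : StrongOn D S := by
      refine StrongOn.of_root (c 0) ?_ ?_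
      · rintro _ (⟨a, ha, rfl⟩ | ⟨b, hb, rfl⟩)
        · exact c0 a ha
        · exact ((pchain b (m - 1) (by omega) (by omega)).tail
            ⟨hY, pS _ (by omega), cS y hy⟩).trans (c0 y hy)
      · rintro _ (⟨a, ha, rfl⟩ | ⟨b, hb, rfl⟩)
        · exact cchain 0 a (by omega) ha
        · exact ((cchain 0 x (by omega) hx).tail ⟨hX, cS x hx, pS 0 (by omega)⟩).trans
            (pchain 0 b (by omega) hb)
    have hSuniv : S = Set.univ := by
      by_contra hne
      obtain ⟨d, ⟨⟨a, ha, rfl⟩, hxa⟩, -⟩ := hc.existsUnique ⟨x, hx, rfl⟩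
      have := hthin S hne hstr (c x) (cS x hx) (c a) (cS a ha) (g (0 + 1)) (pS 0 (by omega)) hxa hX
      exact hout 0 (by omega) (this ▸ hcC a ha)
    intro v
    have : v ∈ S := hSuniv ▸ Set.mem_univ v
    exact this
  -- Entering the ear late, leaving it early or skipping ahead in it would each give a shorter ear;
  -- backward arcs are not excluded.
  · intro a b ha hb hab
    by_contra hb0
    refine hmin (m - b) (by omega) ⟨fun k => if k = 0 then c a else g (k + b), ?_, ?_, ?_, ?_⟩
    · simpa using hcC a ha
    · simpa [add_comm 1 b] using hout b hb
    · beta_reduce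
      rw [if_neg (by omega), show m - b + 1 + b = m + 1 by omega, hgy]
      exact hcC y hy
    · intro k hk
      rcases k with _ | k
      · simpa [add_comm 1 b] using hab
      · simpa [show k + 1 + 1 + b = k + 1 + b + 1 by omega] using hw (k + 1 + b) (by omega)
  · intro a b ha hb hab
    by_contra hlt
    refine hmin (a + 1) (by omega) ⟨fun k => if k ≤ a + 1 then g k else c b, ?_, ?_, ?_, ?_⟩
    · simpa [hgx] using hcC x hx
    · simpa using hg1
    · simpa using hcC b hb
    · intro k hk
      by_cases hk' : k + 1 ≤ a + 1
      · simpa [hk', show k ≤ a + 1 by omega] using hw k (by omega)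
      · obtain rfl : k = a + 1 := by omega
        simpa using hab
  · intro a b ha hb hab
    by_contra hlt
    refine hmin (m - (b - a - 1)) (by omega)
      ⟨fun k => if k ≤ a + 1 then g k else g (k + (b - a - 1)), ?_, ?_, ?_, ?_⟩
    · simpa [hgx] using hcC x hx
    · simpa using hg1
    · beta_reduce
      rw [if_neg (by omega), show m - (b - a - 1) + 1 + (b - a - 1) = m + 1 by omega, hgy]
      exact hcC y hy
    · intro k hk
      rcases lt_trichotomy k (a + 1) with h1 | h1 | h1
      · simpa [show k ≤ a + 1 by omega, show k + 1 ≤ a + 1 by omega] using hw k (by omega)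
      · subst h1
        simpa [show a + 1 + 1 + (b - a - 1) = b + 1 by omega] using hab
      · simpa [show ¬ k ≤ a + 1 by omega, show ¬ k + 1 ≤ a + 1 by omega,
          show ¬ k ≤ a by omega, show k + 1 + (b - a - 1) = k + (b - a - 1) + 1 by omega] using
          hw (k + (b - a - 1)) (by omega)

/-- Rotation by `t` of the labels `0, …, r - 1`. -/
def rot (r t k : ℕ) : ℕ := if k + t < r then k + t else k + t - r

theorem rot_lt {r t k : ℕ} (ht : t < r) (hk : k < r) : rot r t k < r := by
  unfold rot; split_ifs <;> omega

theorem exists_rot_eq {r t : ℕ} (ht : t < r) {a : ℕ} (ha : a < r) : ∃ k < r, rot r t k = a := by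
  unfold rot
  by_cases h : t ≤ a
  · exact ⟨a - t, by omega, by rw [if_pos (by omega)]; omega⟩
  · exact ⟨a + r - t, by omega, by rw [if_neg (by omega)]; omega⟩

theorem IsEarForm.rotate {D : Digraph V} {r m : ℕ} {c p : ℕ → V} (h : IsEarForm D r m c p)
    {t : ℕ} (ht : t < r) : IsEarForm D r m (fun k => c (rot r t k)) p where
  cycle :=
    { two_le := h.cycle.two_le
      inj := fun a b ha hb he => by
        have := h.cycle.inj _ _ (rot_lt ht ha) (rot_lt ht hb) he
        unfold rot at this
        split_ifs at this <;> omega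
      adj_iff := fun a b ha hb => by
        rw [h.cycle.adj_iff _ _ (rot_lt ht ha) (rot_lt ht hb)]
        unfold rot
        split_ifs <;> omega }
  one_le := h.one_le
  inj := h.inj
  disj a b ha hb := h.disj _ _ (rot_lt ht ha) hb
  cover v := by
    rcases h.cover v with ⟨a, ha, rfl⟩ | hv
    · obtain ⟨k, hk, rfl⟩ := exists_rot_eq ht ha
      exact Or.inl ⟨k, hk, rfl⟩
    · exact Or.inr hv
  enter a b ha hb := h.enter _ _ (rot_lt ht ha) hb
  leave a b ha hb := h.leave _ _ ha (rot_lt ht hb)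
  step := h.step
  noskip := h.noskip
  exists_enter := by
    obtain ⟨a, ha, h1⟩ := h.exists_enter
    obtain ⟨k, hk, rfl⟩ := exists_rot_eq ht ha
    exact ⟨k, hk, h1⟩
  exists_leave := by
    obtain ⟨a, ha, h1⟩ := h.exists_leave
    obtain ⟨k, hk, rfl⟩ := exists_rot_eq ht ha
    exact ⟨k, hk, h1⟩

/-- If the ear returns to `c 0`, leaves from `c x`, and misses part of the cycle, then
`c 0, …, c x` together with the ear is an induced cycle. -/
theorem IsEarForm.thin_segment {D : Digraph V} (hthin : IsThin D) {r m : ℕ} {c p : ℕ → V}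
    (h : IsEarForm D r m c p) (h0 : D.Adj (p (m - 1)) (c 0)) {x : ℕ} (hx : x + 1 < r)
    (hX : D.Adj (c x) (p 0)) :
    (∀ a < x, ¬ D.Adj (c a) (p 0)) ∧ (∀ b, 0 < b → b ≤ x → ¬ D.Adj (p (m - 1)) (c b)) ∧
      ∀ a b, b < a → a < m → ¬ D.Adj (p a) (p b) := by
  have h1 := h.one_le
  set S : Set V := {v | (∃ a ≤ x, v = c a) ∨ (∃ b < m, v = p b)} with hS
  have cS : ∀ a, a ≤ x → c a ∈ S := fun a ha => Or.inl ⟨a, ha, rfl⟩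
  have pS : ∀ b, b < m → p b ∈ S := fun b hb => Or.inr ⟨b, hb, rfl⟩
  have cstep : ∀ a, a + 1 < r → D.Adj (c a) (c (a + 1)) := fun a ha =>
    (h.cycle.adj_iff a (a + 1) (by omega) ha).2 (Or.inl rfl)
  have cchain : ∀ a b, a ≤ b → b ≤ x →
      ReflTransGen (fun a b => D.Adj a b ∧ a ∈ S ∧ b ∈ S) (c a) (c b) := fun a b hab hb =>
    ReflTransGen.of_chain hab fun k _ h => ⟨cstep k (by omega), cS k (by omega), cS _ (by omega)⟩
  have pchain : ∀ a b, a ≤ b → b < m →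
      ReflTransGen (fun a b => D.Adj a b ∧ a ∈ S ∧ b ∈ S) (p a) (p b) :=
    fun a b hab hb => ReflTransGen.of_chain hab fun k _ _ =>
      ⟨h.step k (by omega), pS k (by omega), pS _ (by omega)⟩
  have hp0 : ∀ b, b < m → ReflTransGen (fun a b => D.Adj a b ∧ a ∈ S ∧ b ∈ S) (p b) (c 0) :=
    fun b hb => (pchain b (m - 1) (by omega) (by omega)).tail
      ⟨h0, pS _ (by omega), cS 0 (by omega)⟩
  have hcp : ∀ a, a ≤ x → ReflTransGen (fun a b => D.Adj a b ∧ a ∈ S ∧ b ∈ S) (c a) (p 0) :=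
    fun a ha => (cchain a x ha le_rfl).tail ⟨hX, cS x le_rfl, pS 0 (by omega)⟩
  have hstr : StrongOn D S := by
    refine StrongOn.of_root (c 0) ?_ ?_
    · rintro _ (⟨a, ha, rfl⟩ | ⟨b, hb, rfl⟩)
      · exact (hcp a ha).trans (hp0 0 (by omega))
      · exact hp0 b hb
    · rintro _ (⟨a, ha, rfl⟩ | ⟨b, hb, rfl⟩)
      · exact cchain 0 a (by omega) ha
      · exact (hcp 0 (by omega)).trans (pchain 0 b (by omega) hb)
  -- The hypothesis `x + 1 < r` is what leaves `c (x + 1)` outside `S`. Each forbidden arc would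
  -- then be a second way out of a vertex of `S` that already has a successor on the closed segment.
  have hne : S ≠ Set.univ := by
    intro he
    have : c (x + 1) ∈ S := he ▸ Set.mem_univ _
    rcases this with ⟨a, ha, he⟩ | ⟨b, hb, he⟩
    · have := h.cycle.inj _ _ hx (by omega) he
      omega
    · exact h.disj _ _ hx hb he
  have hS2 := hthin S hne hstr
  refine ⟨fun a ha hXa => ?_, fun b hb hbx hYb => ?_, fun a b hba ha hab => ?_⟩
  · exact h.disj (a + 1) 0 (by omega) (by omega)
      (hS2 (c a) (cS a ha.le) _ (cS (a + 1) ha) _ (pS 0 (by omega)) (cstep a (by omega)) hXa)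
  · have := h.cycle.inj _ _ (by omega) (by omega) (hS2 (p (m - 1)) (pS _ (by omega)) _
      (cS 0 (by omega)) _ (cS b hbx) h0 hYb)
    omega
  · by_cases hm : a + 1 < m
    · have := h.inj _ _ (by omega) (by omega) (hS2 (p a) (pS _ ha) _
        (pS b (by omega)) _ (pS (a + 1) hm) hab (h.step a hm))
      omega
    · obtain rfl : a = m - 1 := by omega
      exact h.disj 0 b (by omega) (by omega) (hS2 _ (pS _ ha) _
        (cS 0 (by omega)) _ (pS b (by omega)) h0 hab)

/-- Distinct backward arcs of the ear span disjoint intervals. -/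
theorem IsEarForm.back_disjoint {D : Digraph V} (hthin : IsThin D) {r m : ℕ} {c p : ℕ → V}
    (h : IsEarForm D r m c p) {a b a' b' : ℕ} (hba : b < a) (ha : a < m) (hba' : b' < a')
    (ha' : a' < m) (hab : D.Adj (p a) (p b)) (hab' : D.Adj (p a') (p b')) (haa' : a ≤ a')
    (hne : a ≠ a' ∨ b ≠ b') : a < b' := by
  by_contra hlt
  have h2 := h.cycle.two_le
  -- If the intervals meet, their union is a strong set avoiding the cycle. It branches at `p a`:
  -- towards `p b` and `p b'` when `a = a'`, towards `p b` and `p (a + 1)` otherwise.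
  set S : Set V := {v | ∃ k, b ≤ k ∧ k ≤ a' ∧ v = p k ∨ b' ≤ k ∧ k ≤ a' ∧ v = p k} with hS
  have pS : ∀ k, b ≤ k → k ≤ a' → p k ∈ S := fun k h1 h2 => ⟨k, Or.inl ⟨h1, h2, rfl⟩⟩
  have pS' : ∀ k, b' ≤ k → k ≤ a' → p k ∈ S := fun k h1 h2 => ⟨k, Or.inr ⟨h1, h2, rfl⟩⟩
  have chain : ∀ i j, b ≤ i → i ≤ j → j ≤ a' →
      ReflTransGen (fun a b => D.Adj a b ∧ a ∈ S ∧ b ∈ S) (p i) (p j) :=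
    fun i j hi hij hj => ReflTransGen.of_chain hij fun k _ _ =>
      ⟨h.step k (by omega), pS k (by omega) (by omega), pS _ (by omega) (by omega)⟩
  have chain' : ∀ i j, b' ≤ i → i ≤ j → j ≤ a' →
      ReflTransGen (fun a b => D.Adj a b ∧ a ∈ S ∧ b ∈ S) (p i) (p j) :=
    fun i j hi hij hj => ReflTransGen.of_chain hij fun k _ _ =>
      ⟨h.step k (by omega), pS' k (by omega) (by omega), pS' _ (by omega) (by omega)⟩
  have hb' : ReflTransGen (fun a b => D.Adj a b ∧ a ∈ S ∧ b ∈ S) (p a') (p b') :=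
    ReflTransGen.single ⟨hab', pS _ (by omega) le_rfl, pS' _ le_rfl (by omega)⟩
  have hb : ReflTransGen (fun a b => D.Adj a b ∧ a ∈ S ∧ b ∈ S) (p a') (p b) :=
    (hb'.trans (chain' b' a le_rfl (by omega) haa')).tail
      ⟨hab, pS _ (by omega) haa', pS _ le_rfl (by omega)⟩
  have hstr : StrongOn D S := by
    refine StrongOn.of_root (p a') ?_ ?_
    · rintro _ ⟨k, ⟨h1, h2, rfl⟩ | ⟨h1, h2, rfl⟩⟩
      · exact chain k a' h1 h2 le_rfl
      · exact chain' k a' h1 h2 le_rfl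
    · rintro _ ⟨k, ⟨h1, h2, rfl⟩ | ⟨h1, h2, rfl⟩⟩
      · exact hb.trans (chain b k le_rfl h1 h2)
      · exact hb'.trans (chain' b' k le_rfl h1 h2)
  have hSne : S ≠ Set.univ := by
    intro he
    have : c 0 ∈ S := he ▸ Set.mem_univ _
    obtain ⟨k, ⟨h1, h2, h3⟩ | ⟨h1, h2, h3⟩⟩ := this <;>
      exact h.disj 0 k (by omega) (by omega) h3
  have hS2 := hthin S hSne hstr
  rcases eq_or_ne a a' with rfl | hlt'
  · have := h.inj _ _ (by omega) (by omega)
      (hS2 (p a) (pS _ hba.le le_rfl) _ (pS b le_rfl hba.le) _ (pS' b' le_rfl hba'.le) hab hab')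
    omega
  · have := h.inj _ _ (by omega) (by omega)
      (hS2 (p a) (pS _ hba.le haa') _ (pS b le_rfl (by omega)) _ (pS (a + 1) (by omega) (by omega))
        hab (h.step a (by omega)))
    omega

end CompSpec

/-! ### Integer coordinates for recognising the families -/

namespace CompSpec

variable {V : Type*}

section WrapLabel

/-- The labelling of a cycle by `ZMod n` that gives the label `k` to `g k` for `1 ≤ k ≤ n`. -/
def wrapLabel (n : ℕ) (g : ℕ → V) (z : ZMod n) : V := g (if z.val = 0 then n else z.val)

theorem wrapLabel_natCast {n : ℕ} (g : ℕ → V) {a : ℕ} (h1 : 1 ≤ a) (hn : a ≤ n) :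
    wrapLabel n g (a : ZMod n) = g a := by
  unfold wrapLabel
  rw [ZMod.val_natCast]
  rcases hn.lt_or_eq with h | rfl
  · rw [Nat.mod_eq_of_lt h, if_neg (by omega)]
  · simp

theorem wrapLabel_one {n : ℕ} (g : ℕ → V) (hn : 1 ≤ n) : wrapLabel n g 1 = g 1 := by
  have := wrapLabel_natCast g le_rfl hn
  rwa [Nat.cast_one] at this

theorem wrapLabel_two {n : ℕ} (g : ℕ → V) (hn : 2 ≤ n) : wrapLabel n g 2 = g 2 := by
  have := wrapLabel_natCast g (by omega : 1 ≤ 2) hn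
  rwa [Nat.cast_two] at this

theorem exists_natCast_eq {n : ℕ} (hn : 1 ≤ n) (z : ZMod n) :
    ∃ a : ℕ, 1 ≤ a ∧ a ≤ n ∧ (a : ZMod n) = z := by
  have : NeZero n := ⟨by omega⟩
  by_cases h : z.val = 0
  · refine ⟨n, hn, le_rfl, ?_⟩
    rw [ZMod.natCast_self]
    exact ((ZMod.val_eq_zero z).1 h).symm
  · exact ⟨z.val, by omega, (ZMod.val_lt z).le, ZMod.natCast_zmod_val z⟩

/-- Representing residues by `1, …, n` turns comparison of arc sets into linear arithmetic. -/
theorem cycleArc_wrapLabel_iff {n : ℕ} (hn : 1 ≤ n) (g : ℕ → V) (u v : V) :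
    CycleArc (wrapLabel n g) u v ↔
      ∃ a, 1 ≤ a ∧ a ≤ n ∧ u = g a ∧ v = g (if a = n then 1 else a + 1) := by
  have hsucc : ∀ a : ℕ, 1 ≤ a → a ≤ n →
      wrapLabel n g ((a : ZMod n) + 1) = g (if a = n then 1 else a + 1) := by
    intro a h1 h2
    split_ifs with h
    · rw [h, ZMod.natCast_self, zero_add, wrapLabel_one g hn]
    · rw [← Nat.cast_succ, wrapLabel_natCast g (by omega) (by omega)]
  constructor
  · rintro ⟨z, rfl, rfl⟩
    obtain ⟨a, h1, h2, rfl⟩ := exists_natCast_eq hn z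
    exact ⟨a, h1, h2, wrapLabel_natCast g h1 h2, hsucc a h1 h2⟩
  · rintro ⟨a, h1, h2, rfl, rfl⟩
    exact ⟨a, (wrapLabel_natCast g h1 h2).symm, (hsucc a h1 h2).symm⟩

theorem wrapLabel_injective {n : ℕ} (hn : 1 ≤ n) {g : ℕ → V}
    (hg : ∀ a b, 1 ≤ a → a ≤ n → 1 ≤ b → b ≤ n → g a = g b → a = b) :
    Function.Injective (wrapLabel n g) := by
  intro z w h
  obtain ⟨a, h1, h2, rfl⟩ := exists_natCast_eq hn z
  obtain ⟨b, h3, h4, rfl⟩ := exists_natCast_eq hn w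
  rw [wrapLabel_natCast g h1 h2, wrapLabel_natCast g h3 h4] at h
  rw [hg a b h1 h2 h3 h4 h]

end WrapLabel

/-- `F 0, …, F (n - 1)` enumerates the vertices of `D`, and `R` is its adjacency relation in terms
of the indices. -/
structure IsModel (D : Digraph V) (n : ℕ) (F : ℕ → V) (R : ℕ → ℕ → Prop) : Prop where
  inj : ∀ a b, a < n → b < n → F a = F b → a = b
  cover : ∀ v, ∃ a < n, v = F a
  adj : ∀ a b, a < n → b < n → (D.Adj (F a) (F b) ↔ R a b)

/-- Injectivity suffices, since an injective self-map of a finite set is onto. -/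
theorem IsModel.reindex {D : Digraph V} {n : ℕ} {F : ℕ → V} {R R' : ℕ → ℕ → Prop}
    (h : IsModel D n F R) (σ : ℕ → ℕ) (hlt : ∀ a < n, σ a < n)
    (hinj : ∀ a b, a < n → b < n → σ a = σ b → a = b)
    (hR : ∀ a b, a < n → b < n → (R (σ a) (σ b) ↔ R' a b)) :
    IsModel D n (fun k => F (σ k)) R' where
  inj a b ha hb he := hinj a b ha hb (h.inj _ _ (hlt a ha) (hlt b hb) he)
  cover v := by
    obtain ⟨b, hb, rfl⟩ := h.cover v
    obtain ⟨a, ha, he⟩ := Finset.surj_on_of_inj_on_of_card_le (s := Finset.range n)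
      (t := Finset.range n) (fun a _ => σ a) (fun a ha => by simpa using hlt a (by simpa using ha))
      (fun a b ha hb he => hinj a b (by simpa using ha) (by simpa using hb) he) le_rfl b
      (by simpa using hb)
    exact ⟨a, by simpa using ha, by rw [he]⟩
  adj a b ha hb := by rw [h.adj _ _ (hlt a ha) (hlt b hb), hR a b ha hb]

theorem IsModel.eq_iff {D : Digraph V} {n : ℕ} {F : ℕ → V} {R : ℕ → ℕ → Prop}
    (h : IsModel D n F R) {a b : ℕ} (ha : a < n) (hb : b < n) : F a = F b ↔ a = b :=
  ⟨h.inj a b ha hb, fun e => by rw [e]⟩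

/-! ### Types 3, 4 and 5: a spanning cycle with extra arcs -/

section HamiltonianCycle

/-- The arcs of the cycle `0, 1, …, n - 1`. -/
def cycleRel (n a b : ℕ) : Prop := b = a + 1 ∨ (a + 1 = n ∧ b = 0)

variable {D : Digraph V} {n : ℕ} {F : ℕ → V} {R : ℕ → ℕ → Prop}

theorem IsModel.wrapLabel_bijective (h : IsModel D n F R) (hn : 1 ≤ n) :
    Function.Bijective (wrapLabel n fun k => F (k - 1)) := by
  refine ⟨wrapLabel_injective hn fun a b h1 h2 h3 h4 he => ?_, fun v => ?_⟩
  · have := h.inj _ _ (by omega) (by omega) he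
    omega
  · obtain ⟨a, ha, rfl⟩ := h.cover v
    exact ⟨((a + 1 : ℕ) : ZMod n), wrapLabel_natCast _ (by omega) (by omega)⟩

theorem IsModel.cycleArc_iff (h : IsModel D n F R) (hn : 1 ≤ n) {a b : ℕ} (ha : a < n)
    (hb : b < n) : CycleArc (wrapLabel n fun k => F (k - 1)) (F a) (F b) ↔ cycleRel n a b := by
  rw [cycleArc_wrapLabel_iff hn, cycleRel]
  constructor
  · rintro ⟨k, h1, h2, h3, h4⟩
    have e3 := h.inj _ _ ha (by omega) h3
    have e4 := h.inj _ _ hb (by split_ifs <;> omega) h4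
    split_ifs at e4 <;> omega
  · rintro (rfl | ⟨h1, rfl⟩)
    · exact ⟨a + 1, by omega, by omega, rfl, by rw [if_neg (by omega)]; rfl⟩
    · exact ⟨a + 1, by omega, by omega, rfl, by rw [if_pos h1]⟩

/-- Index `a` carries the label `a + 1`, so a tail labelled `i - 1` reads `a + 2 = i`. -/
theorem IsModel.isType3 {i j : ℕ} (hi : 2 < i) (hij : i < j) (hj : j ≤ n)
    (h : IsModel D n F fun a b =>
      cycleRel n a b ∨ (a = 0 ∧ b + 1 = i) ∨ (a + 2 = i ∧ b + 1 = j)) : IsType3 D := by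
  refine ⟨n, wrapLabel n fun k => F (k - 1), i, j, h.wrapLabel_bijective (by omega), hi, hij, hj, ?_⟩
  intro u v
  obtain ⟨a, ha, rfl⟩ := h.cover u
  obtain ⟨b, hb, rfl⟩ := h.cover v
  rw [h.adj a b ha hb, h.cycleArc_iff (by omega) ha hb, wrapLabel_one _ (by omega),
    wrapLabel_natCast _ (by omega) (by omega), wrapLabel_natCast _ (by omega) (by omega),
    wrapLabel_natCast _ (by omega) (by omega), h.eq_iff ha (by omega), h.eq_iff hb (by omega),
    h.eq_iff ha (by omega), h.eq_iff hb (by omega)]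
  refine or_congr Iff.rfl ?_
  omega

theorem IsModel.isType5 {i j : ℕ} (hi : 3 < i) (hij : i + 1 < j) (hj : j ≤ n)
    (h : IsModel D n F fun a b =>
      cycleRel n a b ∨ (a = 0 ∧ b + 1 = i) ∨ (a + 2 = i ∧ b + 1 = j) ∨ (a + 2 = j ∧ b = 1)) :
    IsType5 D := by
  refine ⟨n, wrapLabel n fun k => F (k - 1), i, j, h.wrapLabel_bijective (by omega), hi, hij, hj, ?_⟩
  intro u v
  obtain ⟨a, ha, rfl⟩ := h.cover u
  obtain ⟨b, hb, rfl⟩ := h.cover v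
  rw [h.adj a b ha hb, h.cycleArc_iff (by omega) ha hb, wrapLabel_one _ (by omega),
    wrapLabel_two _ (by omega),
    wrapLabel_natCast _ (by omega) (by omega), wrapLabel_natCast _ (by omega) (by omega),
    wrapLabel_natCast _ (by omega) (by omega), wrapLabel_natCast _ (by omega) (by omega),
    h.eq_iff ha (by omega), h.eq_iff hb (by omega),
    h.eq_iff ha (by omega), h.eq_iff hb (by omega), h.eq_iff ha (by omega), h.eq_iff hb (by omega)]
  refine or_congr Iff.rfl ?_
  omega

/-- By disjointness each tail carries just one extra arc, so listing the tails in increasing order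
lists the arcs and interleaves their ends as required. -/
theorem IsModel.isType4 {B : ℕ → ℕ → Prop} (h : IsModel D n F fun a b => cycleRel n a b ∨ B a b)
    (hlt : ∀ a b, B a b → b < a ∧ a < n)
    (hdisj : ∀ a b a' b', B a b → B a' b' → a ≤ a' → (a = a' ∧ b = b') ∨ a < b')
    (htwo : ∃ a b a' b', B a b ∧ B a' b' ∧ a ≠ a') : IsType4 D := by
  classical
  set T : Finset ℕ := (Finset.range n).filter fun a => ∃ b, B a b with hT
  have memT : ∀ a, a ∈ T ↔ ∃ b, B a b := by
    intro a
    simp only [hT, Finset.mem_filter, Finset.mem_range, and_iff_right_iff_imp]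
    rintro ⟨b, hb⟩
    exact (hlt a b hb).2
  have hex : ∀ i : Fin T.card, ∃ b, B (T.orderEmbOfFin rfl i) b := fun i =>
    (memT _).1 (T.orderEmbOfFin_mem rfl i)
  choose y hy using hex
  have hcard : 2 ≤ T.card := by
    obtain ⟨a, b, a', b', h1, h2, hne⟩ := htwo
    exact Finset.one_lt_card.2 ⟨a, (memT a).2 ⟨b, h1⟩, a', (memT a').2 ⟨b', h2⟩, hne⟩
  have hn : 1 ≤ n := by
    obtain ⟨a, b, a', b', h1, h2, hne⟩ := htwo
    have := hlt a b h1
    omega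
  refine ⟨n, wrapLabel n fun k => F (k - 1), T.card, fun i => T.orderEmbOfFin rfl i + 1,
    fun i => y i + 1, h.wrapLabel_bijective hn, hcard, fun i => ?_, fun i j hij => ?_, ?_⟩
  · have := hlt _ _ (hy i)
    beta_reduce
    omega
  · beta_reduce
    have h1 : T.orderEmbOfFin rfl i < T.orderEmbOfFin rfl j := (T.orderEmbOfFin rfl).strictMono hij
    rcases hdisj _ _ _ _ (hy i) (hy j) h1.le with h2 | h2 <;> omega
  · intro u v
    obtain ⟨a, ha, rfl⟩ := h.cover u
    obtain ⟨b, hb, rfl⟩ := h.cover v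
    rw [h.adj a b ha hb, h.cycleArc_iff hn ha hb]
    beta_reduce
    refine or_congr Iff.rfl ⟨fun hab => ?_, ?_⟩
    · have : a ∈ Set.range (T.orderEmbOfFin rfl) := by
        rw [Finset.range_orderEmbOfFin]
        exact (memT a).2 ⟨b, hab⟩
      obtain ⟨i, rfl⟩ := this
      refine ⟨i, ?_, ?_⟩
      · rw [wrapLabel_natCast _ (by omega) (by omega)]; rfl
      · have h1 := hlt _ _ (hy i)
        rw [wrapLabel_natCast _ (by omega) (by omega)]
        rcases hdisj _ _ _ _ hab (hy i) le_rfl with h2 | h2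
        · rw [h2.2]; rfl
        · omega
    · rintro ⟨i, h1, h2⟩
      have h3 := hlt _ _ (hy i)
      rw [wrapLabel_natCast _ (by omega) (by omega)] at h1 h2
      have e1 := h.inj _ _ ha (by omega) h1
      have e2 := h.inj _ _ hb (by omega) h2
      simp only [Nat.add_sub_cancel] at e1 e2
      rw [e1, e2]
      exact hy i

end HamiltonianCycle

/-! ### ∞-digraphs, θ-digraphs and Types 1 and 2: a cycle with an ear -/

section Ear

/-- The arcs of a cycle `0, …, r - 1` together with an ear `r, …, r + m - 1` entered from the
vertices in `X` and left to the vertices in `Y`. -/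
def earRel (r m : ℕ) (X Y : ℕ → Prop) (a b : ℕ) : Prop :=
  (a < r ∧ ((b = a + 1 ∧ b < r) ∨ (a + 1 = r ∧ b = 0))) ∨ (a < r ∧ X a ∧ b = r) ∨
    (r ≤ a ∧ b = a + 1) ∨ (a + 1 = r + m ∧ b < r ∧ Y b)

variable {D : Digraph V} {r m : ℕ} {F : ℕ → V} {R : ℕ → ℕ → Prop}

/-- The ear, closed up at the vertex `0`, with labels starting at `1`. -/
def earLabel (r : ℕ) (F : ℕ → V) (k : ℕ) : V := if k = 1 then F 0 else F (r + k - 2)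

theorem IsModel.isCoalescence (h : IsModel D (r + m) F R) (hr : 2 ≤ r) (hm : 1 ≤ m) :
    IsCoalescence r (m + 1) (wrapLabel r fun k => F (k - 1)) (wrapLabel (m + 1) (earLabel r F)) where
  two_le_left := hr
  two_le_right := by omega
  left_injective := wrapLabel_injective (by omega) fun a b h1 h2 h3 h4 he => by
    have := h.inj _ _ (by omega) (by omega) he
    omega
  right_injective := wrapLabel_injective (by omega) fun a b h1 h2 h3 h4 he => by
    unfold earLabel at he
    split_ifs at he <;> first | omega | (have := h.inj _ _ (by omega) (by omega) he; omega)
  base := by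
    rw [wrapLabel_one _ (by omega), wrapLabel_one _ (by omega)]
    rfl
  meet i j hij := by
    obtain ⟨a, h1, h2, rfl⟩ := exists_natCast_eq (by omega) i
    obtain ⟨b, h3, h4, rfl⟩ := exists_natCast_eq (by omega) j
    rw [wrapLabel_natCast _ h1 h2, wrapLabel_natCast _ h3 h4, earLabel] at hij
    split_ifs at hij with hb
    · have := h.inj _ _ (by omega) (by omega) hij
      obtain rfl : a = 1 := by omega
      simp [hb]
    · have := h.inj _ _ (by omega) (by omega) hij
      omega
  cover v := by
    obtain ⟨a, ha, rfl⟩ := h.cover v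
    by_cases har : a < r
    · exact Or.inl ⟨((a + 1 : ℕ) : ZMod r), wrapLabel_natCast _ (by omega) (by omega)⟩
    · refine Or.inr ⟨((a + 2 - r : ℕ) : ZMod (m + 1)), ?_⟩
      rw [wrapLabel_natCast _ (by omega) (by omega), earLabel, if_neg (by omega)]
      congr 1
      omega

theorem IsModel.cycleArc_left_iff (h : IsModel D (r + m) F R) (hr : 2 ≤ r) {a b : ℕ}
    (ha : a < r + m) (hb : b < r + m) :
    CycleArc (wrapLabel r fun k => F (k - 1)) (F a) (F b) ↔
      a < r ∧ ((b = a + 1 ∧ b < r) ∨ (a + 1 = r ∧ b = 0)) := by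
  rw [cycleArc_wrapLabel_iff (by omega)]
  constructor
  · rintro ⟨k, h1, h2, h3, h4⟩
    have e3 := h.inj _ _ ha (by omega) h3
    have e4 := h.inj _ _ hb (by split_ifs <;> omega) h4
    split_ifs at e4 <;> omega
  · rintro ⟨h0, ⟨rfl, h1⟩ | ⟨h1, rfl⟩⟩
    · exact ⟨a + 1, by omega, by omega, rfl, by rw [if_neg (by omega)]; rfl⟩
    · exact ⟨a + 1, by omega, by omega, rfl, by rw [if_pos h1]⟩

theorem IsModel.cycleArc_right_iff (h : IsModel D (r + m) F R) (hr : 2 ≤ r) (hm : 1 ≤ m) {a b : ℕ}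
    (ha : a < r + m) (hb : b < r + m) :
    CycleArc (wrapLabel (m + 1) (earLabel r F)) (F a) (F b) ↔
      (a = 0 ∧ b = r) ∨ (r ≤ a ∧ b = a + 1) ∨ (a + 1 = r + m ∧ b = 0) := by
  rw [cycleArc_wrapLabel_iff (by omega)]
  constructor
  · rintro ⟨k, h1, h2, h3, h4⟩
    unfold earLabel at h3 h4
    split_ifs at h3 h4 <;> first | omega | skip
    all_goals
      have e3 := h.inj _ _ ha (by omega) h3
      have e4 := h.inj _ _ hb (by omega) h4
      omega
  · rintro (⟨rfl, rfl⟩ | ⟨h1, rfl⟩ | ⟨h1, rfl⟩)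
    · refine ⟨1, le_rfl, by omega, rfl, ?_⟩
      rw [if_neg (by omega)]
      simp [earLabel]
    · refine ⟨a + 2 - r, by omega, by omega, ?_, ?_⟩
      · rw [earLabel, if_neg (by omega)]
        congr 1; omega
      · rw [if_neg (by omega), earLabel, if_neg (by omega)]
        congr 1; omega
    · refine ⟨m + 1, by omega, by omega, ?_, ?_⟩
      · rw [earLabel, if_neg (by omega)]
        congr 1; omega
      · rw [if_pos rfl]; simp [earLabel]

theorem IsCoalescence.symm {r s : ℕ} {p : ZMod r → V} {q : ZMod s → V}
    (h : IsCoalescence r s p q) : IsCoalescence s r q p where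
  two_le_left := h.two_le_right
  two_le_right := h.two_le_left
  left_injective := h.right_injective
  right_injective := h.left_injective
  base := h.base.symm
  meet i j hij := (h.meet j i hij.symm).symm
  cover v := (h.cover v).symm

theorem IsModel.isInftyDigraph (hr : 2 ≤ r) (hm : 1 ≤ m)
    (h : IsModel D (r + m) F (earRel r m (fun a => a = 0) fun b => b = 0)) : IsInftyDigraph D := by
  refine ⟨r, m + 1, _, _, h.isCoalescence hr hm, fun u v => ?_⟩
  obtain ⟨a, ha, rfl⟩ := h.cover u
  obtain ⟨b, hb, rfl⟩ := h.cover v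
  rw [h.adj a b ha hb, h.cycleArc_left_iff hr ha hb, h.cycleArc_right_iff hr hm ha hb, earRel]
  omega

theorem earLabel_top (hm : 1 ≤ m) : earLabel r F (m + 1) = F (r + m - 1) := by
  rw [earLabel, if_neg (by omega)]
  congr 1

theorem earLabel_two : earLabel r F 2 = F r := by simp [earLabel]

theorem IsModel.isType1_of_enter (hr : 2 ≤ r) (hm : 1 ≤ m)
    (h : IsModel D (r + m) F (earRel r m (fun a => a = 0 ∨ a + 1 = r) fun b => b = 0)) :
    IsType1 D := by
  refine ⟨r, m + 1, _, _, h.isCoalescence hr hm, fun u v => ?_⟩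
  obtain ⟨a, ha, rfl⟩ := h.cover u
  obtain ⟨b, hb, rfl⟩ := h.cover v
  rw [h.adj a b ha hb, h.cycleArc_left_iff hr ha hb, h.cycleArc_right_iff hr hm ha hb, earRel,
    wrapLabel_natCast _ (by omega) le_rfl, wrapLabel_two _ (by omega), earLabel_two,
    h.eq_iff ha (by omega), h.eq_iff hb (by omega)]
  omega

/-- The extra arc now starts at the end of the ear, so the two cycles of the coalescence exchange
roles. -/
theorem IsModel.isType1_of_leave (hr : 2 ≤ r) (hm : 1 ≤ m)
    (h : IsModel D (r + m) F (earRel r m (fun a => a = 0) fun b => b = 0 ∨ b = 1)) :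
    IsType1 D := by
  refine ⟨m + 1, r, _, _, (h.isCoalescence hr hm).symm, fun u v => ?_⟩
  obtain ⟨a, ha, rfl⟩ := h.cover u
  obtain ⟨b, hb, rfl⟩ := h.cover v
  rw [h.adj a b ha hb, h.cycleArc_left_iff hr ha hb, h.cycleArc_right_iff hr hm ha hb, earRel,
    wrapLabel_natCast _ (by omega) le_rfl, wrapLabel_two _ (by omega), earLabel_top hm,
    h.eq_iff ha (by omega), h.eq_iff hb (by omega)]
  omega

theorem IsModel.isType2 (hr : 2 ≤ r) (hm : 1 ≤ m)
    (h : IsModel D (r + m) F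
      (earRel r m (fun a => a = 0 ∨ a + 1 = r) fun b => b = 0 ∨ b = 1)) : IsType2 D := by
  refine ⟨r, m + 1, _, _, h.isCoalescence hr hm, fun u v => ?_⟩
  obtain ⟨a, ha, rfl⟩ := h.cover u
  obtain ⟨b, hb, rfl⟩ := h.cover v
  rw [h.adj a b ha hb, h.cycleArc_left_iff hr ha hb, h.cycleArc_right_iff hr hm ha hb, earRel,
    wrapLabel_natCast _ (by omega) le_rfl, wrapLabel_two _ (by omega), earLabel_two,
    wrapLabel_natCast _ (by omega) le_rfl, wrapLabel_two _ (by omega), earLabel_top hm,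
    h.eq_iff ha (by omega), h.eq_iff hb (by omega), h.eq_iff ha (by omega), h.eq_iff hb (by omega)]
  omega

theorem pathArc_natCast_iff {k : ℕ} (f : ℕ → V) (u v : V) :
    PathArc (fun i : Fin (k + 2) => f i) u v ↔ ∃ i, i < k + 1 ∧ u = f i ∧ v = f (i + 1) := by
  constructor
  · rintro ⟨i, h1, h2⟩
    exact ⟨i, i.2, h1, h2⟩
  · rintro ⟨i, hi, h1, h2⟩
    exact ⟨⟨i, hi⟩, h1, h2⟩

/-- The positions on the cycle of the path from `x` to `0`. -/
def cyclePath (r x k : ℕ) : ℕ := if x + k < r then x + k else 0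

/-- The positions of the path from `x` to `0` through the ear. -/
def earPath (r m x k : ℕ) : ℕ := if k = 0 then x else if k ≤ m then r + k - 1 else 0

/-- The branch vertices are `w = F x` and `v = F 0`: the rest of the cycle and the ear are parallel
paths from `w` to `v`, and the cycle from 0 to `x` leads back. -/
theorem IsModel.isThetaDigraph {x : ℕ} (hx : 0 < x) (hxr : x < r) (hm : 1 ≤ m)
    (h : IsModel D (r + m) F (earRel r m (fun a => a = x) fun b => b = 0)) :
    IsThetaDigraph D := by
  set P : Fin (r - 1 - x + 2) → V := fun k => F (cyclePath r x k) with hP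
  set Q : Fin (m + 2) → V := fun k => F (earPath r m x k) with hQ
  set S : Fin (x - 1 + 2) → V := fun k => F k with hS
  have lP : ∀ k, cyclePath r x k < r := fun k => by unfold cyclePath; split_ifs <;> omega
  have lQ : ∀ k, earPath r m x k < r + m := fun k => by unfold earPath; split_ifs <;> omega
  have iP : Function.Injective P := fun i j hij => by
    have := h.inj _ _ (by have := lP i; omega) (by have := lP j; omega) hij
    unfold cyclePath at this
    ext
    split_ifs at this <;> omega
  have iQ : Function.Injective Q := fun i j hij => by
    have := h.inj _ _ (lQ i) (lQ j) hij
    unfold earPath at this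
    ext
    split_ifs at this <;> omega
  have iS : Function.Injective S := fun i j hij => by
    have := h.inj _ _ (by omega) (by omega) hij
    ext
    omega
  have mPQ : ∀ i j, P i = Q j → P i = F x ∨ P i = F 0 := fun i j hij => by
    have := h.inj _ _ (by have := lP i; omega) (lQ j) hij
    simp only [hP]
    rw [h.eq_iff (by have := lP i; omega) (by omega), h.eq_iff (by have := lP i; omega) (by omega)]
    unfold cyclePath earPath at *
    split_ifs at * <;> omega
  have mPS : ∀ i j, P i = S j → P i = F x ∨ P i = F 0 := fun i j hij => by
    have := h.inj _ _ (by have := lP i; omega) (by omega) hij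
    simp only [hP]
    rw [h.eq_iff (by have := lP i; omega) (by omega), h.eq_iff (by have := lP i; omega) (by omega)]
    unfold cyclePath at *
    split_ifs at * <;> omega
  have mQS : ∀ i j, Q i = S j → Q i = F x ∨ Q i = F 0 := fun i j hij => by
    have := h.inj _ _ (lQ i) (by omega) hij
    simp only [hQ]
    rw [h.eq_iff (lQ i) (by omega), h.eq_iff (lQ i) (by omega)]
    unfold earPath at *
    split_ifs at * <;> omega
  have P0 : P 0 = F x := by simp [hP, cyclePath, hxr]
  have Q0 : Q 0 = F x := by simp [hQ, earPath]
  have P1 : P (Fin.last _) = F 0 := by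
    simp only [hP, Fin.val_last, cyclePath]
    rw [if_neg (by omega)]
  have Q1 : Q (Fin.last _) = F 0 := by
    simp only [hQ, Fin.val_last, earPath]
    rw [if_neg (by omega), if_neg (by omega)]
  have S1 : S (Fin.last _) = F x := by
    simp only [hS, Fin.val_last]
    congr 1; omega
  have cov : ∀ z, (∃ i, P i = z) ∨ (∃ i, Q i = z) ∨ (∃ i, S i = z) := by
    intro z
    obtain ⟨a, ha, rfl⟩ := h.cover z
    by_cases h1 : a ≤ x
    · exact Or.inr (Or.inr ⟨⟨a, by omega⟩, rfl⟩)
    · by_cases h2 : a < r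
      · refine Or.inl ⟨⟨a - x, by omega⟩, ?_⟩
        simp only [hP, cyclePath]
        rw [if_pos (by omega)]
        congr 1; omega
      · refine Or.inr (Or.inl ⟨⟨a + 1 - r, by omega⟩, ?_⟩)
        simp only [hQ, earPath]
        rw [if_neg (by omega), if_pos (by omega)]
        congr 1; omega
  have hadj : ∀ u v, D.Adj u v ↔ PathArc P u v ∨ PathArc Q u v ∨ PathArc S u v := by
    intro u v
    obtain ⟨a, ha, rfl⟩ := h.cover u
    obtain ⟨b, hb, rfl⟩ := h.cover v
    rw [h.adj a b ha hb, earRel, pathArc_natCast_iff fun k => F (cyclePath r x k),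
      pathArc_natCast_iff fun k => F (earPath r m x k), pathArc_natCast_iff F]
    constructor
    · rintro (⟨h1, ⟨rfl, h2⟩ | ⟨h2, rfl⟩⟩ | ⟨h1, rfl, rfl⟩ | ⟨h1, rfl⟩ | ⟨h1, h2, rfl⟩)
      · by_cases h3 : a < x
        · exact Or.inr (Or.inr ⟨a, by omega, rfl, rfl⟩)
        · refine Or.inl ⟨a - x, by omega, ?_, ?_⟩ <;> unfold cyclePath <;> rw [if_pos (by omega)] <;>
            congr 1 <;> omega
      · refine Or.inl ⟨a - x, by omega, ?_, ?_⟩ <;> unfold cyclePath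
        · rw [if_pos (by omega)]; congr 1; omega
        · rw [if_neg (by omega)]
      · refine Or.inr (Or.inl ⟨0, by omega, ?_, ?_⟩) <;> unfold earPath
        · rw [if_pos rfl]
        · rw [if_neg (by omega), if_pos (by omega)]; congr 1
      · refine Or.inr (Or.inl ⟨a + 1 - r, by omega, ?_, ?_⟩) <;> unfold earPath <;>
          rw [if_neg (by omega), if_pos (by omega)] <;> congr 1 <;> omega
      · refine Or.inr (Or.inl ⟨m, by omega, ?_, ?_⟩) <;> unfold earPath
        · rw [if_neg (by omega), if_pos (by omega)]; congr 1; omega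
        · rw [if_neg (by omega), if_neg (by omega)]
    · rintro (⟨k, h1, h2, h3⟩ | ⟨k, h1, h2, h3⟩ | ⟨k, h1, h2, h3⟩)
      · have e2 := h.inj _ _ ha (by have := lP k; omega) h2
        have e3 := h.inj _ _ hb (by have := lP (k + 1); omega) h3
        unfold cyclePath at e2 e3
        split_ifs at e2 e3 <;> omega
      · have e2 := h.inj _ _ ha (lQ k) h2
        have e3 := h.inj _ _ hb (lQ (k + 1)) h3
        unfold earPath at e2 e3
        split_ifs at e2 e3 <;> first | contradiction | omega
      · have e2 := h.inj _ _ ha (by omega) h2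
        have e3 := h.inj _ _ hb (by omega) h3
        omega
  -- The shorter of the two parallel paths must come first.
  rcases le_total (r - 1 - x) m with hle | hle
  · exact ⟨_, _, _, F x, F 0, P, Q, S, ⟨hle, hm, iP, iQ, iS, P0, Q0, rfl, P1, Q1, S1, mPQ, mPS,
      mQS, cov⟩, hadj⟩
  · refine ⟨_, _, _, F x, F 0, Q, P, S, ⟨hle, by omega, iQ, iP, iS, Q0, P0, rfl, Q1, P1, S1,
      fun i j hij => hij ▸ mPQ j i hij.symm, mQS, mPS, fun z => or_left_comm.1 (cov z)⟩,
      fun u v => by rw [hadj, or_left_comm]⟩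

end Ear

end CompSpec

/-! ### Case analysis on entries, exits and backward arcs -/

namespace CompSpec

variable {V : Type*} {D : Digraph V} {r m : ℕ} {c p : ℕ → V}

/-- The cycle followed by the ear. -/
def join (r : ℕ) (c p : ℕ → V) (k : ℕ) : V := if k < r then c k else p (k - r)

theorem join_of_lt {k : ℕ} (h : k < r) : join r c p k = c k := if_pos h

theorem join_of_le {k : ℕ} (h : r ≤ k) : join r c p k = p (k - r) := if_neg (by omega)

theorem IsEarForm.isModel (hsimple : IsSimple D) (h : IsEarForm D r m c p) :
    IsModel D (r + m) (join r c p) fun a b =>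
      earRel r m (fun a => D.Adj (c a) (p 0)) (fun b => D.Adj (p (m - 1)) (c b)) a b ∨
        (r ≤ b ∧ b < a ∧ D.Adj (p (a - r)) (p (b - r))) where
  inj a b ha hb he := by
    rcases lt_or_ge a r with h1 | h1 <;> rcases lt_or_ge b r with h2 | h2
    · rw [join_of_lt h1, join_of_lt h2] at he
      exact h.cycle.inj a b h1 h2 he
    · rw [join_of_lt h1, join_of_le h2] at he
      exact absurd he (h.disj _ _ h1 (by omega))
    · rw [join_of_le h1, join_of_lt h2] at he
      exact absurd he.symm (h.disj _ _ h2 (by omega))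
    · rw [join_of_le h1, join_of_le h2] at he
      have := h.inj _ _ (by omega) (by omega) he
      omega
  cover v := by
    rcases h.cover v with ⟨a, ha, rfl⟩ | ⟨b, hb, rfl⟩
    · exact ⟨a, by omega, (join_of_lt ha).symm⟩
    · refine ⟨r + b, by omega, ?_⟩
      rw [join_of_le (by omega)]
      simp
  adj a b ha hb := by
    have hm := h.one_le
    unfold earRel
    rcases lt_or_ge a r with h1 | h1 <;> rcases lt_or_ge b r with h2 | h2
    · rw [join_of_lt h1, join_of_lt h2, h.cycle.adj_iff a b h1 h2]
      omega
    · rw [join_of_lt h1, join_of_le h2]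
      constructor
      · intro hab
        have := h.enter _ _ h1 (by omega) hab
        rw [this] at hab
        exact Or.inl (Or.inr (Or.inl ⟨h1, hab, by omega⟩))
      · rintro ((h3 | ⟨-, h3, rfl⟩ | h3 | h3) | h3)
        · omega
        · simpa using h3
        · omega
        · omega
        · omega
    · rw [join_of_le h1, join_of_lt h2]
      constructor
      · intro hab
        have := h.leave _ _ (by omega) h2 hab
        rw [show a - r = m - 1 by omega] at hab
        exact Or.inl (Or.inr (Or.inr (Or.inr ⟨by omega, h2, hab⟩)))
      · rintro ((h3 | h3 | h3 | ⟨h3, -, h4⟩) | h3)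
        · omega
        · omega
        · omega
        · rwa [show a - r = m - 1 by omega]
        · omega
    · rw [join_of_le h1, join_of_le h2]
      constructor
      · intro hab
        have h3 := h.noskip _ _ (by omega) (by omega) hab
        have h4 : a ≠ b := fun e => hsimple _ (e ▸ hab)
        rcases lt_or_ge b a with h5 | h5
        · exact Or.inr ⟨h2, h5, hab⟩
        · exact Or.inl (Or.inr (Or.inr (Or.inl ⟨h1, by omega⟩)))
      · rintro ((h3 | h3 | ⟨-, rfl⟩ | h3) | h3)
        · omega
        · omega
        · rw [show a + 1 - r = a - r + 1 by omega]
          exact h.step _ (by omega)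
        · omega
        · exact h3.2.2

theorem IsEarForm.isModel_earRel (hsimple : IsSimple D) (h : IsEarForm D r m c p)
    (hback : ∀ a b, b < a → a < m → ¬ D.Adj (p a) (p b)) {X Y : ℕ → Prop}
    (hX : ∀ a < r, D.Adj (c a) (p 0) ↔ X a) (hY : ∀ b < r, D.Adj (p (m - 1)) (c b) ↔ Y b) :
    IsModel D (r + m) (join r c p) (earRel r m X Y) := by
  refine (h.isModel hsimple).reindex id (fun a ha => ha) (fun a b _ _ he => he) ?_
  intro a b ha hb
  simp only [id, earRel]
  have h1 : ¬ (r ≤ b ∧ b < a ∧ D.Adj (p (a - r)) (p (b - r))) := fun ⟨h1, h2, h3⟩ =>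
    hback _ _ (by omega) (by omega) h3
  rw [or_iff_left h1]
  refine or_congr Iff.rfl (or_congr ?_ (or_congr Iff.rfl ?_))
  · exact and_congr_right fun h => and_congr (hX a h) Iff.rfl
  · exact and_congr_right fun _ => and_congr_right fun h => hY b h

theorem rot_zero {t : ℕ} (ht : t < r) : rot r t 0 = t := by
  unfold rot; rw [zero_add, if_pos ht]

/-- The general form of `IsEarForm.thin_segment`, with the ear returning to `c y`. -/
theorem IsEarForm.thin_segment_rot (hthin : IsThin D) (h : IsEarForm D r m c p) {y : ℕ}
    (hy : y < r) (hY : D.Adj (p (m - 1)) (c y)) {k : ℕ} (hk : k + 1 < r)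
    (hX : D.Adj (c (rot r y k)) (p 0)) :
    (∀ a < k, ¬ D.Adj (c (rot r y a)) (p 0)) ∧
      (∀ b, 0 < b → b ≤ k → ¬ D.Adj (p (m - 1)) (c (rot r y b))) ∧
      ∀ a b, b < a → a < m → ¬ D.Adj (p a) (p b) :=
  (h.rotate hy).thin_segment hthin (by rw [rot_zero hy]; exact hY) hk hX

theorem IsEarForm.exists_rotate_leave (h : IsEarForm D r m c p) :
    ∃ c', IsEarForm D r m c' p ∧ D.Adj (p (m - 1)) (c' 0) := by
  obtain ⟨y, hy, hY⟩ := h.exists_leave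
  exact ⟨_, h.rotate hy, by rw [rot_zero hy]; exact hY⟩

/-- An ear with backward arcs gives a digraph of Type 4. -/
theorem IsEarForm.isType4 (hsimple : IsSimple D) (hthin : IsThin D) (h : IsEarForm D r m c p)
    (h0 : D.Adj (p (m - 1)) (c 0)) (hback : ∃ a b, b < a ∧ a < m ∧ D.Adj (p a) (p b)) :
    IsType4 D := by
  obtain ⟨a₀, b₀, hba₀, ha₀, hab₀⟩ := hback
  have hr := h.cycle.two_le
  -- A backward arc is tolerated only if the segment from exit to entry fills the whole cycle; this
  -- pins down the entry here and the exit below.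
  have hX : ∀ x < r, D.Adj (c x) (p 0) → x + 1 = r := by
    intro x hx hX
    by_contra hne
    exact (h.thin_segment hthin h0 (by omega) hX).2.2 a₀ b₀ hba₀ ha₀ hab₀
  have hXr : D.Adj (c (r - 1)) (p 0) := by
    obtain ⟨x, hx, hx'⟩ := h.exists_enter
    have := hX x hx hx'
    rwa [show r - 1 = x by omega]
  have hY : ∀ y < r, D.Adj (p (m - 1)) (c y) → y = 0 := by
    intro y hy hY
    by_contra hne
    refine (h.thin_segment_rot hthin hy hY (k := r - 1 - y) (by omega) ?_).2.2 a₀ b₀ hba₀ ha₀ hab₀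
    rw [show rot r y (r - 1 - y) = r - 1 by unfold rot; rw [if_pos (by omega)]; omega]
    exact hXr
  have hm := h.one_le
  -- The cycle followed by the ear is now a spanning cycle, and the old closing arc from `r - 1` to
  -- 0 becomes one of its backward arcs.
  have hM : IsModel D (r + m) (join r c p) fun a b => cycleRel (r + m) a b ∨
      ((a + 1 = r ∧ b = 0) ∨ (r ≤ b ∧ b < a ∧ a < r + m ∧ D.Adj (p (a - r)) (p (b - r)))) := by
    refine (h.isModel hsimple).reindex id (fun a ha => ha) (fun a b _ _ he => he) ?_
    intro a b ha hb
    simp only [id, earRel, cycleRel]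
    constructor
    · rintro ((h1 | ⟨h1, h2, h3⟩ | h1 | ⟨h1, h2, h3⟩) | h1)
      · omega
      · have := hX a h1 h2
        omega
      · omega
      · have := hY b h2 h3
        omega
      · exact Or.inr (Or.inr ⟨h1.1, h1.2.1, ha, h1.2.2⟩)
    · rintro ((h1 | h1) | h1 | h1)
      · by_cases h2 : a + 1 = r
        · refine Or.inl (Or.inr (Or.inl ⟨by omega, ?_, by omega⟩))
          rwa [show a = r - 1 by omega]
        · left; omega
      · refine Or.inl (Or.inr (Or.inr (Or.inr ⟨h1.1, by omega, ?_⟩)))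
        rwa [h1.2]
      · left; omega
      · exact Or.inr ⟨h1.1, h1.2.1, h1.2.2.2⟩
  refine hM.isType4 ?_ ?_ ⟨r - 1, 0, r + a₀, r + b₀, Or.inl ⟨by omega, rfl⟩, Or.inr ?_, by omega⟩
  · rintro a b (h1 | h1) <;> omega
  · rintro a b a' b' (h1 | h1) (h2 | h2) hle
    · omega
    · omega
    · omega
    · by_cases he : a = a' ∧ b = b'
      · exact Or.inl he
      · have := h.back_disjoint hthin (by omega) (by omega) (by omega) (by omega) h1.2.2.2
          h2.2.2.2 (by omega) (by omega)
        omega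
  · refine ⟨by omega, by omega, by omega, ?_⟩
    simpa using hab₀

section Reindexing

variable {F : ℕ → V}

/-- The spanning cycle runs through `0, …, r - 1` and the ear. Read from `x`, its extra arcs `x → r`
and `r - 1 → 0` become `(1, i)` and `(i - 1, j)`. -/
theorem IsModel.isType3_of_enter {x : ℕ} (hx : 0 < x) (hxr : x + 1 < r) (hm : 1 ≤ m)
    (h : IsModel D (r + m) F (earRel r m (fun a => a = x ∨ a + 1 = r) fun b => b = 0)) :
    IsType3 D := by
  refine IsModel.isType3 (i := r - x + 1) (j := r - x + m + 1) (by omega) (by omega) (by omega)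
    (h.reindex (rot (r + m) x) (fun a ha => rot_lt (by omega) ha) ?_ ?_) <;>
  · intro a b ha hb
    unfold rot
    try unfold earRel cycleRel
    split_ifs <;> omega

theorem IsModel.isType3_of_leave {y : ℕ} (hy : 0 < y) (hyr : y + 1 < r) (hm : 1 ≤ m)
    (h : IsModel D (r + m) F (earRel r m (fun a => a + 1 = r) fun b => b = 0 ∨ b = y)) :
    IsType3 D := by
  refine IsModel.isType3 (i := m + 2) (j := m + 2 + y) (by omega) (by omega) (by omega)
    (h.reindex (rot (r + m) (r - 1)) (fun a ha => rot_lt (by omega) ha) ?_ ?_) <;>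
  · intro a b ha hb
    unfold rot
    try unfold earRel cycleRel
    split_ifs <;> omega

/-- As for Type 3, with the second exit supplying `(j - 1, 2)`; `m ≥ 2` is exactly `i + 1 < j`. -/
theorem IsModel.isType5_of_ear {x : ℕ} (hx : 0 < x) (hxr : x + 2 < r) (hm : 2 ≤ m)
    (h : IsModel D (r + m) F
      (earRel r m (fun a => a = x ∨ a + 1 = r) fun b => b = 0 ∨ b = x + 1)) : IsType5 D := by
  refine IsModel.isType5 (i := r - x + 1) (j := r - x + m + 1) (by omega) (by omega) (by omega)
    (h.reindex (rot (r + m) x) (fun a ha => rot_lt (by omega) ha) ?_ ?_) <;>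
  · intro a b ha hb
    unfold rot
    try unfold earRel cycleRel
    split_ifs <;> omega

/-- Rotation of the cycle that brings `r - 1` to `0` and fixes the ear. -/
def cycleShift (r k : ℕ) : ℕ := if k = 0 then r - 1 else if k < r then k - 1 else k

theorem IsModel.cycleShift {X Y X' Y' : ℕ → Prop} (hr : 2 ≤ r) (hm : 1 ≤ m)
    (h : IsModel D (r + m) F (earRel r m X Y))
    (hX : ∀ a < r, X (cycleShift r a) ↔ X' a) (hY : ∀ a < r, Y (cycleShift r a) ↔ Y' a) :
    IsModel D (r + m) (fun k => F (cycleShift r k)) (earRel r m X' Y') := by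
  have hlt : ∀ a, CompSpec.cycleShift r a < r ↔ a < r := fun a => by
    unfold CompSpec.cycleShift; split_ifs <;> omega
  refine h.reindex _ ?_ ?_ ?_
  · intro a ha
    unfold CompSpec.cycleShift; split_ifs <;> omega
  · intro a b ha hb
    unfold CompSpec.cycleShift; split_ifs <;> omega
  · intro a b ha hb
    unfold earRel
    refine or_congr ?_ (or_congr ?_ (or_congr ?_ ?_))
    · unfold CompSpec.cycleShift; split_ifs <;> omega
    · rw [hlt]
      refine and_congr_right fun h => and_congr (hX a h) ?_
      unfold CompSpec.cycleShift; split_ifs <;> omega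
    · unfold CompSpec.cycleShift; split_ifs <;> omega
    · rw [hlt]
      refine and_congr ?_ (and_congr_right fun h => hY b h)
      unfold CompSpec.cycleShift; split_ifs <;> omega

/-- With a one-vertex ear, the ear vertex is the common vertex of two cycles. -/
theorem IsModel.isType2_of_singleton {x : ℕ} (hx : 0 < x) (hxr : x + 2 < r)
    (h : IsModel D (r + 1) F
      (earRel r 1 (fun a => a = x ∨ a + 1 = r) fun b => b = 0 ∨ b = x + 1)) : IsType2 D := by
  have hn : r + 1 = r - x + (x + 1) := by omega
  rw [hn] at h
  refine IsModel.isType2 (r := r - x) (m := x + 1) (by omega) (by omega)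
    -- The new cycle is `r, x + 1, …, r - 1`, and the new ear is `0, …, x`.
    (h.reindex (fun k => if k = 0 then r else if k < r - x then x + k else k - (r - x)) ?_ ?_ ?_)
  · intro a ha
    split_ifs <;> omega
  · intro a b ha hb
    split_ifs <;> omega
  · intro a b ha hb
    unfold earRel
    dsimp only
    split_ifs <;> omega

end Reindexing

/-- Besides the entry `r - 1` and the exit 0 there is at most one further entry `x` and one further
exit `y`, and if both exist then `y = x + 1`: any other position puts a forbidden entry or exit
inside a segment that the ear closes into an induced cycle. -/
theorem IsEarForm.family_of_consecutive (hsimple : IsSimple D) (hthin : IsThin D)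
    (h : IsEarForm D r m c p) (hback : ∀ a b, b < a → a < m → ¬ D.Adj (p a) (p b))
    (h0 : D.Adj (p (m - 1)) (c 0)) (hr1 : D.Adj (c (r - 1)) (p 0)) :
    InftyFamily D ∨ ThetaFamily D := by
  have hr := h.cycle.two_le
  have hm := h.one_le
  have seg : ∀ x, x + 1 < r → D.Adj (c x) (p 0) → (∀ a < x, ¬ D.Adj (c a) (p 0)) ∧
      (∀ b, 0 < b → b ≤ x → ¬ D.Adj (p (m - 1)) (c b)) := fun x hx hX =>
    ⟨(h.thin_segment hthin h0 hx hX).1, (h.thin_segment hthin h0 hx hX).2.1⟩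
  have rot_eq : ∀ y z, y ≤ z → z < r → rot r y (z - y) = z := fun y z h1 h2 => by
    unfold rot; rw [if_pos (by omega)]; omega
  have seg' : ∀ y, 0 < y → y < r → D.Adj (p (m - 1)) (c y) →
      (∀ z, y ≤ z → z + 1 < r → ¬ D.Adj (c z) (p 0)) ∧
      (∀ z, y < z → z < r → ¬ D.Adj (p (m - 1)) (c z)) := by
    intro y hy0 hy hY
    have := h.thin_segment_rot hthin hy hY (k := r - 1 - y) (by omega)
      (by rw [rot_eq y _ (by omega) (by omega)]; exact hr1)
    refine ⟨fun z h1 h2 hz => this.1 (z - y) (by omega) ?_,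
      fun z h1 h2 hz => this.2.1 (z - y) (by omega) (by omega) ?_⟩
    · rwa [rot_eq y z h1 (by omega)]
    · rwa [rot_eq y z (by omega) (by omega)]
  -- The segment from `y` to `x` wraps around through the entry `r - 1` and misses `x + 1`.
  have seg'' : ∀ x y, x + 1 < y → y < r → D.Adj (c x) (p 0) → ¬ D.Adj (p (m - 1)) (c y) := by
    intro x y hxy hy hX hY
    have := h.thin_segment_rot hthin hy hY (k := x + r - y) (by omega) (by
      rw [show rot r y (x + r - y) = x by unfold rot; rw [if_neg (by omega)]; omega]; exact hX)
    refine this.1 (r - 1 - y) (by omega) ?_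
    rw [rot_eq y _ (by omega) (by omega)]
    exact hr1
  have adjr : ∀ a, a + 1 = r → D.Adj (c a) (p 0) := fun a ha => by
    rwa [show a = r - 1 by omega]
  have hXset : ∀ x, x + 1 < r → D.Adj (c x) (p 0) →
      ∀ a < r, D.Adj (c a) (p 0) ↔ a = x ∨ a + 1 = r := by
    intro x hx hX a ha
    constructor
    · intro hXa
      by_contra hc
      rcases lt_trichotomy a x with h1 | h1 | h1
      · exact (seg x hx hX).1 a h1 hXa
      · omega
      · exact (seg a (by omega) hXa).1 x h1 hX
    · rintro (rfl | h1)
      · exact hX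
      · exact adjr a h1
  have hYset : ∀ y, 0 < y → y < r → D.Adj (p (m - 1)) (c y) →
      ∀ b < r, D.Adj (p (m - 1)) (c b) ↔ b = 0 ∨ b = y := by
    intro y hy0 hy hY b hb
    constructor
    · intro hYb
      by_contra hc
      rcases lt_trichotomy b y with h1 | h1 | h1
      · exact (seg' b (by omega) hb hYb).2 y h1 hy hY
      · omega
      · exact (seg' y hy0 hy hY).2 b h1 hb hYb
    · rintro (rfl | rfl)
      · exact h0
      · exact hY
  by_cases hx : ∃ x, x + 1 < r ∧ D.Adj (c x) (p 0)
  · obtain ⟨x, hxr, hX⟩ := hx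
    by_cases hy : ∃ y, 0 < y ∧ y < r ∧ D.Adj (p (m - 1)) (c y)
    · obtain ⟨y, hy0, hyr, hY⟩ := hy
      obtain rfl : y = x + 1 := by
        by_contra hne
        rcases lt_or_ge x y with h1 | h1
        · exact seg'' x y (by omega) hyr hX hY
        · exact (seg' y hy0 hyr hY).1 x h1 hxr hX
      have hM := h.isModel_earRel hsimple hback (hXset x hxr hX) (hYset _ hy0 hyr hY)
      rcases Nat.eq_zero_or_pos x with rfl | hx0
      · exact Or.inl (Or.inr (Or.inr (hM.isType2 hr hm)))
      · rcases eq_or_ne (x + 2) r with h2 | h2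
        -- Here the entries are `r - 2, r - 1` and the exits `r - 1, 0`; shifting makes `r - 1` the
        -- common vertex.
        · refine Or.inl (Or.inr (Or.inr ((hM.cycleShift hr hm ?_ ?_).isType2 hr hm))) <;>
          · intro a ha
            unfold cycleShift
            split_ifs <;> omega
        · rcases eq_or_ne m 1 with rfl | hm1
          · exact Or.inl (Or.inr (Or.inr (hM.isType2_of_singleton hx0 (by omega))))
          · exact Or.inr (Or.inr (Or.inr (Or.inr (hM.isType5_of_ear hx0 (by omega) (by omega)))))
    · have hM := h.isModel_earRel hsimple hback (hXset x hxr hX) (Y := fun b => b = 0)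
        fun b hb => ⟨fun hYb => by
          by_contra hc
          exact hy ⟨b, by omega, hb, hYb⟩, fun e => by rwa [e]⟩
      rcases Nat.eq_zero_or_pos x with rfl | hx0
      · exact Or.inl (Or.inr (Or.inl (hM.isType1_of_enter hr hm)))
      · exact Or.inr (Or.inr (Or.inl (hM.isType3_of_enter hx0 hxr hm)))
  · have hXone : ∀ a < r, D.Adj (c a) (p 0) ↔ a + 1 = r := fun a ha =>
      ⟨fun hXa => by
        by_contra hc
        exact hx ⟨a, by omega, hXa⟩, adjr a⟩
    by_cases hy : ∃ y, 0 < y ∧ y < r ∧ D.Adj (p (m - 1)) (c y)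
    · obtain ⟨y, hy0, hyr, hY⟩ := hy
      have hM := h.isModel_earRel hsimple hback hXone (hYset _ hy0 hyr hY)
      rcases eq_or_ne (y + 1) r with h1 | h1
      · refine Or.inl (Or.inr (Or.inl ((hM.cycleShift hr hm ?_ ?_).isType1_of_leave hr hm))) <;>
        · intro a ha
          unfold cycleShift
          split_ifs <;> omega
      · exact Or.inr (Or.inr (Or.inl (hM.isType3_of_leave hy0 (by omega) hm)))
    · have hM := h.isModel_earRel hsimple hback (X := fun a => a = r - 1) (Y := fun b => b = 0)
        (fun a ha => (hXone a ha).trans (by omega))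
        fun b hb => ⟨fun hYb => by
          by_contra hc
          exact hy ⟨b, by omega, hb, hYb⟩, fun e => by rwa [e]⟩
      exact Or.inr (Or.inl (hM.isThetaDigraph (by omega) (by omega) hm))

theorem IsEarForm.family (hsimple : IsSimple D) (hthin : IsThin D)
    (h : IsEarForm D r m c p) (h0 : D.Adj (p (m - 1)) (c 0)) : InftyFamily D ∨ ThetaFamily D := by
  have hr := h.cycle.two_le
  have hm := h.one_le
  by_cases hback : ∃ a b, b < a ∧ a < m ∧ D.Adj (p a) (p b)
  · exact Or.inr (Or.inr (Or.inr (Or.inl (h.isType4 hsimple hthin h0 hback))))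
  push Not at hback
  have hback' : ∀ a b, b < a → a < m → ¬ D.Adj (p a) (p b) := hback
  by_cases hcons : ∃ x y, x < r ∧ y < r ∧ D.Adj (c x) (p 0) ∧ D.Adj (p (m - 1)) (c y) ∧
      (y = x + 1 ∨ (x + 1 = r ∧ y = 0))
  · obtain ⟨x, y, hx, hy, hX, hY, hxy⟩ := hcons
    refine (h.rotate hy).family_of_consecutive hsimple hthin hback' ?_ ?_
    · rw [rot_zero hy]; exact hY
    · rw [show rot r y (r - 1) = x by unfold rot; split_ifs <;> omega]; exact hX
  obtain ⟨x, hx, hX⟩ := h.exists_enter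
  have hlast : ∀ a < r, D.Adj (c a) (p 0) → a + 1 < r := fun a ha hXa => by
    by_contra hc
    exact hcons ⟨a, 0, ha, by omega, hXa, h0, Or.inr ⟨by omega, rfl⟩⟩
  have hXset : ∀ a < r, D.Adj (c a) (p 0) ↔ a = x := by
    refine fun a ha => ⟨fun hXa => ?_, fun e => by rwa [e]⟩
    rcases lt_trichotomy a x with h1 | h1 | h1
    · exact absurd hXa ((h.thin_segment hthin h0 (hlast x hx hX) hX).1 a h1)
    · exact h1
    · exact absurd hX ((h.thin_segment hthin h0 (hlast a ha hXa) hXa).1 x h1)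
  have hYset : ∀ b < r, D.Adj (p (m - 1)) (c b) ↔ b = 0 := by
    refine fun b hb => ⟨fun hYb => ?_, fun e => by rwa [e]⟩
    by_contra hb0
    have h1 : x < b := by
      by_contra hle
      exact (h.thin_segment hthin h0 (hlast x hx hX) hX).2.1 b (by omega) (by omega) hYb
    have h2 : b ≠ x + 1 := fun e => hcons ⟨x, b, hx, hb, hX, hYb, Or.inl e⟩
    -- A second exit `b > x + 1` would give a segment from `b` around to `x` that contains the exit
    -- 0.
    refine (h.thin_segment_rot hthin hb hYb (k := x + r - b) (by omega) ?_).2.1 (r - b) (by omega)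
      (by omega) ?_
    · rw [show rot r b (x + r - b) = x by unfold rot; rw [if_neg (by omega)]; omega]; exact hX
    · rw [show rot r b (r - b) = 0 by unfold rot; rw [if_neg (by omega)]; omega]; exact h0
  have hM := h.isModel_earRel hsimple hback' hXset hYset
  rcases Nat.eq_zero_or_pos x with rfl | hx0
  · exact Or.inl (Or.inl (hM.isInftyDigraph hr hm))
  · exact Or.inr (Or.inl (hM.isThetaDigraph hx0 hx hm))

end CompSpec

/-- A strongly connected finite simple digraph with exactly three complementarity eigenvalues
belongs to the `∞`-family or to the `θ`-family. -/
theorem mainTheorem1 {V : Type*} [Fintype V] (D : Digraph V)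
    (hsimple : CompSpec.IsSimple D) (hstrong : CompSpec.IsStronglyConnected D)
    (hthree : (CompSpec.complementaritySpectrum D).ncard = 3) :
    CompSpec.InftyFamily D ∨ CompSpec.ThetaFamily D := by
  have hbr := CompSpec.exists_branching_of_ncard_eq_three hthree
  obtain ⟨u, v, w, huv, -, -⟩ := id hbr
  obtain ⟨r, c, hc⟩ := CompSpec.exists_isInducedCycle hsimple hstrong huv
  have hr := hc.two_le
  have hthin : CompSpec.IsThin D := CompSpec.isThin_of_ncard_eq_three hsimple hstrong hthree
    (C := {v | ∃ a < r, v = c a}) ⟨c 0, 0, by omega, rfl⟩ fun _ hu => hc.existsUnique hu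
  obtain ⟨m, p, h⟩ := hc.exists_isEarForm hstrong hthin hbr
  obtain ⟨c', h', h0⟩ := h.exists_rotate_leave
  exact h'.family hsimple hthin h0
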